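/- Let $(M,h)$ be a $2$-sphere of revolution: a compact smooth Riemannian surface homeomorphic to $S^2$ with a point $p$ (a pole) such that any two points at the same $h$-distance from $p$ are mapped one to the other by an $h$-isometry fixing $p$. Let $q$ be the opposite pole, $d_h(p,q)=2a$, and let $(r,\theta)\in(0,2a)\times\mathbb{R}/2\pi\mathbb{Z}$ be geodesic polar coordinates around $p$ on $M\setminus\{p,q\}$. Let $\mu\in\mathbb{R}$ satisfy $|\mu|\,\|\partial/\partial\theta\|_h<1$ on $M\setminus\{p,q\}$, let $W=\mu\,\partial/\partial\theta$ (with $W=0$ at $p$ and $q$), let $\varphi:\mathbb{R}\times M\to M$ be its (smooth, global) flow, and let $F$ be the Randers metric with navigation data $(h,W)$, $$F(x,y)=\frac{\sqrt{\lambda\|y\|_h^2+h(W,y)^2}}{\lambda}-\frac{h(W,y)}{\lambda},\qquad \lambda=1-\|W\|_h^2 .$$ For $G\in\{h,F\}$, a $G$-unit speed geodesic on a compact interval is a $C^\infty$ curve of $G$-speed one that locally minimizes the $G$-length among piecewise $C^\infty$ curves with the same initial point and the same end point. For $l>0$ and a curve $c$ with $c(0)=x$, the point $c(l)$ is a $G$-cut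 point of $x$ along $c$ if $c|_{[0,l]}$ is a $G$-unit speed geodesic which minimizes the $G$-length from $x$ to $c(l)$, and no $G$-unit speed geodesic $c^*:[0,t_1]\to M$ with $t_1>l$ and $c^*|_{[0,l]}=c|_{[0,l]}$ minimizes the $G$-length from $x$ to $c^*(t_1)$. Let $x\in M$, $l>0$, let $\gamma:[0,l]\to M$ be an $h$-unit speed geodesic with $\gamma(0)=x$, and put $\mathcal{P}(s)=\varphi(s,\gamma(s))$. Then $\mathcal{P}$ is an $F$-unit speed geodesic on $[0,l]$ with $\mathcal{P}(0)=x$, and $\mathcal{P}(l)$ is an $F$-cut point of $x$ along $\mathcal{P}$ if and only if $\gamma(l)$ is an $h$-cut point of $x$ along $\gamma$. -/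

import Mathlib

open Set Filter MeasureTheory Manifold Bundle
open scoped Topology ContDiff

namespace RandersSphere

noncomputable section

variable {M : Type*} [MetricSpace M] [ChartedSpace (EuclideanSpace ℝ (Fin 2)) M]

/-- The velocity vector `ċ(t)` of a curve `c` in the surface `M`. -/
def velocity (c : ℝ → M) (t : ℝ) : TangentSpace (𝓡 2) (c t) :=
  mfderiv 𝓘(ℝ, ℝ) (𝓡 2) c t (1 : ℝ)

/-- The integral length of the restriction of `c` to `[a, b]`, with respect to a (possibly
non-reversible) norm function `F(x, y)` on the tangent bundle. -/
def length (F : (x : M) → TangentSpace (𝓡 2) x → ℝ) (c : ℝ → M) (a b : ℝ) : ℝ :=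
  ∫ t in a..b, F (c t) (velocity c t)

/-- `c` is a piecewise `C^∞` curve on `[a, b]`: the interval has a finite partition such that `c`
is `C^∞` on each of the closed subintervals (in particular, `c` is continuous on `[a, b]`). -/
def PiecewiseSmooth (c : ℝ → M) (a b : ℝ) : Prop :=
  ∃ (n : ℕ) (t : ℕ → ℝ), Monotone t ∧ t 0 = a ∧ t n = b ∧
    ∀ i < n, ContMDiffOn 𝓘(ℝ, ℝ) (𝓡 2) ∞ c (Icc (t i) (t (i + 1)))

/-- `c` restricted to `[u, v]` has minimal `F`-length among all piecewise `C^∞` curves with the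
same initial point and the same end point. -/
def IsMinimizing (F : (x : M) → TangentSpace (𝓡 2) x → ℝ) (c : ℝ → M) (u v : ℝ) : Prop :=
  ∀ (σ : ℝ → M) (a b : ℝ), a ≤ b → PiecewiseSmooth σ a b → σ a = c u → σ b = c v →
    length F c u v ≤ length F σ a b

/-- `c` restricted to `[a, b]` is an `F`-unit speed `F`-geodesic: a `C^∞` curve of `F`-speed one
which is locally minimizing. -/
structure IsUnitGeodesic (F : (x : M) → TangentSpace (𝓡 2) x → ℝ) (c : ℝ → M) (a b : ℝ) :
    Prop where
  smooth : ContMDiffOn 𝓘(ℝ, ℝ) (𝓡 2) ∞ c (Icc a b)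
  unit_speed : ∀ t ∈ Ioo a b, F (c t) (velocity c t) = 1
  locally_minimizing : ∀ t ∈ Icc a b, ∃ ε > 0, ∀ u ∈ Icc a b, ∀ v ∈ Icc a b,
    |u - t| < ε → |v - t| < ε → u ≤ v → IsMinimizing F c u v

/-- `c(l)` is an `F`-cut point of `x` along `c`: the restriction of `c` to `[0, l]` is a minimal
`F`-geodesic segment issuing from `x`, and no geodesic segment that extends it beyond `c(l)` is
minimizing. -/
structure IsCutPoint (F : (x : M) → TangentSpace (𝓡 2) x → ℝ) (x : M) (c : ℝ → M) (l : ℝ) :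
    Prop where
  pos : 0 < l
  start : c 0 = x
  geodesic : IsUnitGeodesic F c 0 l
  minimizing : IsMinimizing F c 0 l
  not_minimizing_beyond : ∀ (t₁ : ℝ) (c' : ℝ → M), l < t₁ → EqOn c' c (Icc 0 l) →
    IsUnitGeodesic F c' 0 t₁ → ¬ IsMinimizing F c' 0 t₁

/-- A global smooth flow `φ` of the vector field `W` on `M`. -/
structure IsSmoothFlow (W : (x : M) → TangentSpace (𝓡 2) x) (φ : ℝ → M → M) : Prop where
  smooth : ContMDiff (𝓘(ℝ, ℝ).prod (𝓡 2)) (𝓡 2) ∞ (fun z : ℝ × M => φ z.1 z.2)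
  zero : ∀ x, φ 0 x = x
  integralCurve : ∀ x, IsMIntegralCurve (I := 𝓡 2) (fun s => φ s x) W

variable [RiemannianBundle (fun x : M => TangentSpace (𝓡 2) x)]

/-- The norm function of the Riemannian metric `h` of `M`. -/
def hNorm (x : M) (y : TangentSpace (𝓡 2) x) : ℝ := ‖y‖

/-- The Randers metric `F = α + β` induced by the navigation data `(h, W)`:
`F(x, y) = √(λ ‖y‖² + W₀²) / λ - W₀ / λ` with `λ = 1 - ‖W‖²` and `W₀ = h(W, y)`. -/
def randers (W : (x : M) → TangentSpace (𝓡 2) x) (x : M) (y : TangentSpace (𝓡 2) x) : ℝ :=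
  Real.sqrt ((1 - ‖W x‖ ^ 2) * ‖y‖ ^ 2 + (inner ℝ (W x) y) ^ 2) / (1 - ‖W x‖ ^ 2)
    - inner ℝ (W x) y / (1 - ‖W x‖ ^ 2)

/-- `f` preserves the Riemannian metric of `M`. -/
def PreservesMetric (f : M → M) : Prop :=
  ∀ (x : M) (v : TangentSpace (𝓡 2) x), ‖mfderiv (𝓡 2) (𝓡 2) f x v‖ = ‖v‖

/-- `p` is a pole of `M`: any two points at the same distance from `p` are interchanged by an
isometry of `M` that fixes `p`. -/
def IsPole (p : M) : Prop :=
  ∀ q₁ q₂ : M, dist p q₁ = dist p q₂ →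
    ∃ f : M ≃ₘ^∞⟮𝓡 2, 𝓡 2⟯ M, PreservesMetric f ∧ f q₁ = q₂ ∧ f p = p

/-- `M` is a 2-sphere of revolution with pole `p`: a compact surface homeomorphic to the 2-sphere
for which `p` is a pole. -/
structure IsTwoSphereOfRevolution (p : M) : Prop where
  compact : CompactSpace M
  sphere : Nonempty (M ≃ₜ Metric.sphere (0 : EuclideanSpace ℝ (Fin 3)) 1)
  pole : IsPole p

/-- `Φ(r, θ)` are geodesic polar coordinates around `p`, defined on `M ∖ {p, q}` for
`0 < r < 2a`, where `2a = d_h(p, q)`. The curves `r ↦ Φ(r, θ)` are the unit speed geodesics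
issuing from `p` with initial vector `cos θ • e₁ + sin θ • e₂` for an orthonormal basis `e₁, e₂`
of the tangent plane at `p`, and they minimize the distance from `p`. -/
structure IsGeodesicPolar (p q : M) (a : ℝ) (Φ : ℝ × ℝ → M) : Prop where
  a_pos : 0 < a
  dist_poles : dist p q = 2 * a
  smooth : ContMDiffOn 𝓘(ℝ, ℝ × ℝ) (𝓡 2) ∞ Φ (Ioo (-(2 * a)) (2 * a) ×ˢ univ)
  center : ∀ θ, Φ (0, θ) = p
  initial : ∃ e₁ e₂ : TangentSpace (𝓡 2) p, ‖e₁‖ = 1 ∧ ‖e₂‖ = 1 ∧ inner ℝ e₁ e₂ = 0 ∧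
    ∀ θ, (⟨Φ (0, θ), velocity (fun r => Φ (r, θ)) 0⟩ : TangentBundle (𝓡 2) M)
      = ⟨p, Real.cos θ • e₁ + Real.sin θ • e₂⟩
  unit_speed : ∀ r ∈ Ioo 0 (2 * a), ∀ θ, ‖velocity (fun ρ => Φ (ρ, θ)) r‖ = 1
  dist_pole : ∀ r ∈ Ioo 0 (2 * a), ∀ θ, dist p (Φ (r, θ)) = r
  periodic : ∀ r ∈ Ioo 0 (2 * a), ∀ θ, Φ (r, θ + 2 * Real.pi) = Φ (r, θ)
  bijOn : BijOn Φ (Ioo 0 (2 * a) ×ˢ Ico 0 (2 * Real.pi)) {p, q}ᶜ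
  immersion : ∀ r ∈ Ioo 0 (2 * a), ∀ θ,
    Function.Injective (mfderiv 𝓘(ℝ, ℝ × ℝ) (𝓡 2) Φ (r, θ))

/-- The coordinate vector field `∂/∂θ` at the point `Φ(r, θ)`. -/
def dTheta (Φ : ℝ × ℝ → M) (r θ : ℝ) : TangentSpace (𝓡 2) (Φ (r, θ)) :=
  velocity (fun t => Φ (r, t)) θ

/-- The wind `W = μ ∂/∂θ` blowing along the parallels; it vanishes at the poles `p` and `q`. -/
structure IsRotationalWind (p q : M) (a : ℝ) (Φ : ℝ × ℝ → M) (μ : ℝ)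
    (W : (x : M) → TangentSpace (𝓡 2) x) : Prop where
  eq_dTheta : ∀ r ∈ Ioo 0 (2 * a), ∀ θ, W (Φ (r, θ)) = μ • dTheta Φ r θ
  north : W p = 0
  south : W q = 0

end

end RandersSphere

/-! The wind $W$ is a Killing field, so each flow map $\varphi_s$ is an $h$-isometry; it also
preserves $W$, hence it preserves $F$. Zermelo navigation describes $F$ by its balls:
$F(x,y)\le\tau$ if and only if $\|y-\tau W\|_h\le\tau$ (`randers_le_iff`). By the chain rule,
$c\mapsto\varphi(s,c(s))$ therefore turns $h$-unit speed into $F$-unit speed, and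
$c\mapsto\varphi(-s,c(s))$ undoes this.

Both directions are instances of one relation, `Transfers F G V ψ`, under which minimality passes
back from $s\mapsto\psi_s(c(s))$ to $c$ (`Transfers.isMinimizing`). Suppose some curve from $c(u)$
to $c(v)$ had $F$-length below $v-u$. Carried along by the flow, it yields a $G$-path of length at
most some $s<v-u$ from $c(u)$ to $\psi_s(c(v))$ (`Transfers.exists_reach`). Apply $\psi_u$, then
drift with the flow for the remaining time $v-u-s$: since $G(V)<1$, the drift costs less $G$-length
than time. The image of $c$ would then not be minimizing. Geodesics and cut points follow formally,
because extensions correspond under the two inverse operations.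

For the Killing property, an isometry fixing $p$ acts in polar coordinates by $\theta\mapsto
g\mp\theta$, so $\|\partial/\partial\theta\|$ depends on $r$ alone
(`IsGeodesicPolar.norm_dTheta_eq`). With the Gauss lemma, the shift $\theta\mapsto\theta+\mu s$ is
isometric off the poles, and by density everywhere. -/

namespace RandersSphere

/-! ### Velocity, length and concatenation of piecewise smooth curves -/

section Curves

variable {M : Type*} [MetricSpace M] [ChartedSpace (EuclideanSpace ℝ (Fin 2)) M]

theorem eval_velocity_congr (F : (x : M) → TangentSpace (𝓡 2) x → ℝ) {c c' : ℝ → M} {t : ℝ}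
    (h : c =ᶠ[𝓝 t] c') : F (c t) (velocity c t) = F (c' t) (velocity c' t) := by
  have key : ∀ (x x' : M) (v : EuclideanSpace ℝ (Fin 2)), x = x' → F x v = F x' v := by
    rintro x _ v rfl; rfl
  have h1 : (velocity c t : EuclideanSpace ℝ (Fin 2)) = velocity c' t := by
    unfold velocity
    rw [h.mfderiv_eq]; rfl
  exact (congrArg (F (c t)) h1).trans (key _ _ _ h.eq_of_nhds)

theorem length_congr (F : (x : M) → TangentSpace (𝓡 2) x → ℝ) {c c' : ℝ → M} {a b : ℝ}
    (hab : a ≤ b) (h : EqOn c c' (Icc a b)) : length F c a b = length F c' a b := by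
  unfold length
  -- The endpoints are discarded because the two-sided velocity there depends on values outside `[a,
  -- b]`.
  rw [intervalIntegral.integral_of_le hab, intervalIntegral.integral_of_le hab,
    integral_Ioc_eq_integral_Ioo, integral_Ioc_eq_integral_Ioo]
  refine setIntegral_congr_fun measurableSet_Ioo fun t ht => ?_
  refine eval_velocity_congr F ?_
  filter_upwards [Ioo_mem_nhds ht.1 ht.2] with s hs using h ⟨hs.1.le, hs.2.le⟩

theorem PiecewiseSmooth.congr {c c' : ℝ → M} {a b : ℝ} (hc : PiecewiseSmooth c a b)
    (h : EqOn c c' (Icc a b)) : PiecewiseSmooth c' a b := by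
  obtain ⟨n, t, ht, h0, hn, hs⟩ := hc
  refine ⟨n, t, ht, h0, hn, fun i hi => (hs i hi).congr fun s hs' => (h ?_).symm⟩
  exact ⟨h0 ▸ (ht (Nat.zero_le i)).trans hs'.1, hn ▸ hs'.2.trans (ht hi)⟩

theorem PiecewiseSmooth.append {c : ℝ → M} {a b d : ℝ} (h₁ : PiecewiseSmooth c a b)
    (h₂ : PiecewiseSmooth c b d) : PiecewiseSmooth c a d := by
  obtain ⟨n, t, ht, h0, hn, hs⟩ := h₁
  obtain ⟨m, u, hu, k0, km, ks⟩ := h₂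
  obtain ⟨w, hw⟩ : ∃ w : ℕ → ℝ, w = fun i => if i ≤ n then t i else u (i - n) := ⟨_, rfl⟩
  have e1 : ∀ i, i ≤ n → w i = t i := fun i hi => by simp [hw, hi]
  have e2 : ∀ i, n ≤ i → w i = u (i - n) := fun i hi => by
    rcases hi.eq_or_lt with rfl | hi
    · simp [hw, hn, k0]
    · simp [hw, not_le.2 hi]
  refine ⟨n + m, w, ?_, ?_, ?_, ?_⟩
  · refine monotone_nat_of_le_succ fun i => ?_
    rcases lt_or_ge i n with hi | hi
    · rw [e1 i hi.le, e1 (i + 1) hi]; exact ht (Nat.le_succ i)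
    · rw [e2 i hi, e2 (i + 1) (by omega)]; exact hu (by omega)
  · rw [e1 0 (Nat.zero_le n), h0]
  · rw [e2 (n + m) (by omega), ← km]; congr 1; omega
  · intro i hi
    rcases lt_or_ge i n with hi' | hi'
    · rw [e1 i hi'.le, e1 (i + 1) hi']; exact hs i hi'
    · rw [e2 i hi', e2 (i + 1) (by omega), show i + 1 - n = i - n + 1 by omega]
      exact ks _ (by omega)

theorem PiecewiseSmooth.of_contMDiffOn {c : ℝ → M} {a b : ℝ} (hab : a ≤ b)
    (h : ContMDiffOn 𝓘(ℝ, ℝ) (𝓡 2) ∞ c (Icc a b)) : PiecewiseSmooth c a b := by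
  refine ⟨1, fun i => if i = 0 then a else b, ?_, by simp, by simp, fun i hi => ?_⟩
  · refine monotone_nat_of_le_succ fun i => ?_
    by_cases hi : i = 0 <;> simp [hi, hab]
  · obtain rfl : i = 0 := by omega
    simpa using h

theorem PiecewiseSmooth.comp_add_const {c : ℝ → M} {a b : ℝ} (h : PiecewiseSmooth c a b) (k : ℝ) :
    PiecewiseSmooth (fun t => c (t + k)) (a - k) (b - k) := by
  obtain ⟨n, t, ht, h0, hn, hs⟩ := h
  refine ⟨n, fun i => t i - k, fun i j hij => sub_le_sub_right (ht hij) k, by simp [h0],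
    by simp [hn], fun i hi => (hs i hi).comp (t := Icc (t i) (t (i + 1))) ?_ fun s hs' => ?_⟩
  · exact (contDiff_id.add contDiff_const).contMDiff.contMDiffOn
  · exact ⟨by linarith [hs'.1], by linarith [hs'.2]⟩

theorem velocity_comp_add_const (c : ℝ → M) (k t : ℝ) :
    velocity (fun s => c (s + k)) t = velocity c (t + k) := by
  have h1 : HasMFDerivAt 𝓘(ℝ, ℝ) 𝓘(ℝ, ℝ) (fun s : ℝ => s + k) t
      (ContinuousLinearMap.id ℝ ℝ) :=
    ((hasFDerivAt_id t).add_const k).hasMFDerivAt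
  by_cases hd : MDifferentiableAt 𝓘(ℝ, ℝ) (𝓡 2) c (t + k)
  · have := (hd.hasMFDerivAt.comp t h1).mfderiv
    unfold velocity
    change mfderiv 𝓘(ℝ, ℝ) (𝓡 2) (c ∘ fun s => s + k) t (1 : ℝ) = _
    rw [this]; rfl
  -- Where `c` is not differentiable both velocities take the default value `0`, so no regularity is
  -- needed.
  · have hd' : ¬ MDifferentiableAt 𝓘(ℝ, ℝ) (𝓡 2) (fun s => c (s + k)) t := by
      intro h
      apply hd
      have h2 : HasMFDerivAt 𝓘(ℝ, ℝ) 𝓘(ℝ, ℝ) (fun s : ℝ => s + -k) (t + k)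
          (ContinuousLinearMap.id ℝ ℝ) :=
        ((hasFDerivAt_id (t + k)).add_const (-k)).hasMFDerivAt
      have h3 : MDifferentiableAt 𝓘(ℝ, ℝ) (𝓡 2) (fun s => c (s + k)) (t + k + -k) := by
        simpa using h
      have := h3.comp (t + k) h2.mdifferentiableAt
      simpa [Function.comp_def] using this
    unfold velocity
    rw [mfderiv_zero_of_not_mdifferentiableAt hd, mfderiv_zero_of_not_mdifferentiableAt hd']
    rfl

theorem length_comp_add_const (F : (x : M) → TangentSpace (𝓡 2) x → ℝ) (c : ℝ → M) (a b k : ℝ) :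
    length F (fun t => c (t + k)) (a - k) (b - k) = length F c a b := by
  unfold length
  have := intervalIntegral.integral_comp_add_right (a := a - k) (b := b - k)
    (fun t => F (c t) (velocity c t)) k
  simp only [sub_add_cancel] at this
  rw [← this]
  refine intervalIntegral.integral_congr fun t _ => ?_
  simp only [velocity_comp_add_const]

/-- There is a piecewise smooth curve from `x` to `y` of `F`-length at most `L`. -/
def Reach (F : (x : M) → TangentSpace (𝓡 2) x → ℝ) (x y : M) (L : ℝ) : Prop :=
  ∃ (σ : ℝ → M) (a b : ℝ), a ≤ b ∧ PiecewiseSmooth σ a b ∧ σ a = x ∧ σ b = y ∧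
    length F σ a b ≤ L

theorem isMinimizing_iff_reach {F : (x : M) → TangentSpace (𝓡 2) x → ℝ} {c : ℝ → M} {u v : ℝ} :
    IsMinimizing F c u v ↔ ∀ L, Reach F (c u) (c v) L → length F c u v ≤ L :=
  ⟨fun h _ ⟨σ, a, b, hab, hσ, ha, hb, hL⟩ => (h σ a b hab hσ ha hb).trans hL,
    fun h σ a b hab hσ ha hb => h _ ⟨σ, a, b, hab, hσ, ha, hb, le_rfl⟩⟩

variable [IsManifold (𝓡 2) ∞ M]

/-- The derivative within `[a, b]` is continuous up to the endpoints, where `velocity` need not be;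
it agrees with `velocity` inside. -/
theorem exists_continuousOn_eval_velocity {F : (x : M) → TangentSpace (𝓡 2) x → ℝ}
    (hF : Continuous fun v : TangentBundle (𝓡 2) M => F v.1 v.2) {c : ℝ → M} {a b : ℝ}
    (hab : a < b) (hc : ContMDiffOn 𝓘(ℝ, ℝ) (𝓡 2) ∞ c (Icc a b)) :
    ∃ g : ℝ → ℝ, ContinuousOn g (Icc a b) ∧
      ∀ t ∈ Ioo a b, F (c t) (velocity c t) = g t := by
  have h1 : ContinuousOn (tangentMapWithin 𝓘(ℝ, ℝ) (𝓡 2) c (Icc a b))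
      (TotalSpace.proj ⁻¹' (Icc a b)) :=
    hc.continuousOn_tangentMapWithin (by simp) (uniqueDiffOn_Icc hab).uniqueMDiffOn
  have h2 : Continuous fun t : ℝ => (⟨t, (1 : ℝ)⟩ : TangentBundle 𝓘(ℝ, ℝ) ℝ) := by
    exact (tangentBundleModelSpaceHomeomorph 𝓘(ℝ, ℝ)).symm.continuous.comp
      (continuous_id.prodMk continuous_const)
  refine ⟨fun t => F _ (tangentMapWithin 𝓘(ℝ, ℝ) (𝓡 2) c (Icc a b) ⟨t, (1 : ℝ)⟩).2,
    hF.comp_continuousOn (h1.comp h2.continuousOn fun t ht => ht), fun t ht => ?_⟩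
  simp only [tangentMapWithin]
  rw [mfderivWithin_of_mem_nhds (Icc_mem_nhds ht.1 ht.2)]
  rfl

theorem intervalIntegrable_of_contMDiffOn {F : (x : M) → TangentSpace (𝓡 2) x → ℝ}
    (hF : Continuous fun v : TangentBundle (𝓡 2) M => F v.1 v.2) {c : ℝ → M} {a b : ℝ}
    (hab : a ≤ b) (hc : ContMDiffOn 𝓘(ℝ, ℝ) (𝓡 2) ∞ c (Icc a b)) :
    IntervalIntegrable (fun t => F (c t) (velocity c t)) volume a b := by
  rcases hab.eq_or_lt with rfl | hab'
  · simp
  obtain ⟨g, hg, hgF⟩ := exists_continuousOn_eval_velocity hF hab' hc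
  have hi : IntervalIntegrable g volume a b := by
    apply ContinuousOn.intervalIntegrable; rwa [uIcc_of_le hab]
  rw [intervalIntegrable_iff_integrableOn_Ioo_of_le hab] at hi ⊢
  exact hi.congr_fun (fun t ht => (hgF t ht).symm) measurableSet_Ioo

theorem PiecewiseSmooth.intervalIntegrable {F : (x : M) → TangentSpace (𝓡 2) x → ℝ}
    (hF : Continuous fun v : TangentBundle (𝓡 2) M => F v.1 v.2) {c : ℝ → M} {a b : ℝ}
    (hc : PiecewiseSmooth c a b) :
    IntervalIntegrable (fun t => F (c t) (velocity c t)) volume a b := by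
  obtain ⟨n, t, ht, rfl, rfl, hs⟩ := hc
  exact IntervalIntegrable.trans_iterate fun i hi =>
    intervalIntegrable_of_contMDiffOn hF (ht (Nat.le_succ i)) (hs i hi)

theorem Reach.trans {F : (x : M) → TangentSpace (𝓡 2) x → ℝ}
    (hF : Continuous fun v : TangentBundle (𝓡 2) M => F v.1 v.2) {x y z : M} {L L' : ℝ}
    (h₁ : Reach F x y L) (h₂ : Reach F y z L') : Reach F x z (L + L') := by
  obtain ⟨σ, a, b, hab, hσ, ha, hb, hL⟩ := h₁
  obtain ⟨τ, d, e, hde, hτ, hd, he, hL'⟩ := h₂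
  have hτ' := hτ.comp_add_const (d - b)
  have hlen := length_comp_add_const F τ d e (d - b)
  set ρ : ℝ → M := fun t => if t ≤ b then σ t else τ (t + (d - b)) with hρ
  have e1 : EqOn σ ρ (Icc a b) := fun t ht => by simp [hρ, ht.2]
  have hdb : d - (d - b) = b := by ring
  rw [hdb] at hτ' hlen
  have hbe : b ≤ e - (d - b) := by linarith
  have e2 : EqOn (fun t => τ (t + (d - b))) ρ (Icc b (e - (d - b))) := fun t ht => by
    rcases ht.1.eq_or_lt with rfl | hlt
    · simp [hρ, hb, hd]
    · simp [hρ, not_le.2 hlt]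
  have p1 := hσ.congr e1
  have p2 := hτ'.congr e2
  refine ⟨ρ, a, e - (d - b), hab.trans hbe, p1.append p2, ?_, ?_, ?_⟩
  · rw [← e1 ⟨le_rfl, hab⟩, ha]
  · rw [← e2 ⟨hbe, le_rfl⟩]; simp [he]
  · have : length F ρ a (e - (d - b)) = length F ρ a b + length F ρ b (e - (d - b)) :=
      (intervalIntegral.integral_add_adjacent_intervals (p1.intervalIntegrable hF)
        (p2.intervalIntegrable hF)).symm
    rw [this, ← length_congr F hab e1, ← length_congr F hbe e2, hlen]
    linarith

end Curves

/-! ### Flows: group law, smoothness of the field, invariance of the field -/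

section Flow

variable {M : Type*} [MetricSpace M] [ChartedSpace (EuclideanSpace ℝ (Fin 2)) M]
  {V : (x : M) → TangentSpace (𝓡 2) x} {ψ : ℝ → M → M}

namespace IsSmoothFlow

theorem contMDiff_time (h : IsSmoothFlow V ψ) (s : ℝ) : ContMDiff (𝓡 2) (𝓡 2) ∞ (ψ s) :=
  h.smooth.comp (contMDiff_const.prodMk contMDiff_id)

theorem mdifferentiableAt_time (h : IsSmoothFlow V ψ) (s : ℝ) (x : M) :
    MDifferentiableAt (𝓡 2) (𝓡 2) (ψ s) x :=
  (h.contMDiff_time s).mdifferentiable (by simp) x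

theorem mfderiv_uncurry (h : IsSmoothFlow V ψ) (s : ℝ) (x : M) (r : ℝ)
    (y : TangentSpace (𝓡 2) x) :
    mfderiv (𝓘(ℝ, ℝ).prod (𝓡 2)) (𝓡 2) (fun z : ℝ × M => ψ z.1 z.2) (s, x)
      ((r, y) : ℝ × EuclideanSpace ℝ (Fin 2)) =
      r • V (ψ s x) + mfderiv (𝓡 2) (𝓡 2) (ψ s) x y := by
  refine (mfderiv_prod_eq_add_apply (h.smooth.mdifferentiable (by simp) (s, x))).trans ?_
  congr 1
  have : mfderiv 𝓘(ℝ, ℝ) (𝓡 2) (fun z => ψ z x) s = _ := (h.integralCurve x s).mfderiv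
  change mfderiv 𝓘(ℝ, ℝ) (𝓡 2) (fun z => ψ z x) s r = _
  rw [this]
  rfl

/-- The motion composed with the drift has the drift velocity, scaled by the clock rate `T'`, added
to the transported velocity. This is the infinitesimal form of navigation. -/
theorem velocity_comp (h : IsSmoothFlow V ψ) {T : ℝ → ℝ} {T' t : ℝ} {c : ℝ → M}
    (hT : HasDerivAt T T' t) (hc : MDifferentiableAt 𝓘(ℝ, ℝ) (𝓡 2) c t) :
    velocity (fun s => ψ (T s) (c s)) t =
      T' • V (ψ (T t) (c t)) + mfderiv (𝓡 2) (𝓡 2) (ψ (T t)) (c t) (velocity c t) := by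
  have h1 : HasMFDerivAt 𝓘(ℝ, ℝ) 𝓘(ℝ, ℝ) T t _ := hT.hasFDerivAt.hasMFDerivAt
  have h2 := h1.prodMk hc.hasMFDerivAt
  have h3 : MDifferentiableAt (𝓘(ℝ, ℝ).prod (𝓡 2)) (𝓡 2) (fun z : ℝ × M => ψ z.1 z.2)
    (T t, c t) := h.smooth.mdifferentiable (by simp) _
  have h4 := (h3.hasMFDerivAt.comp t h2).mfderiv
  unfold velocity
  change mfderiv 𝓘(ℝ, ℝ) (𝓡 2) ((fun z : ℝ × M => ψ z.1 z.2) ∘ fun s => (T s, c s)) t (1 : ℝ) = _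
  rw [h4, ← h.mfderiv_uncurry]
  have h5 : (ContinuousLinearMap.toSpanSingleton ℝ T') (1 : ℝ) = T' := by simp
  have h6 : (((ContinuousLinearMap.toSpanSingleton ℝ T') (1 : ℝ), velocity c t) :
      ℝ × EuclideanSpace ℝ (Fin 2)) = (T', velocity c t) := by rw [h5]; rfl
  exact congrArg (mfderiv (𝓘(ℝ, ℝ).prod (𝓡 2)) (𝓡 2) (fun z : ℝ × M => ψ z.1 z.2) (T t, c t)) h6

theorem reverse (h : IsSmoothFlow V ψ) : IsSmoothFlow (fun x => -V x) (fun s => ψ (-s)) where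
  smooth := h.smooth.comp (contMDiff_fst.neg.prodMk contMDiff_snd)
  zero x := by simp [h.zero]
  integralCurve x := by
    have := (h.integralCurve x).comp_mul (-1)
    convert! this using 1
    · ext s; simp
    · ext1 y; simp

variable [IsManifold (𝓡 2) ∞ M]

/-- Smoothness of the field is inherited from the flow: `V` is the tangent map of
$(s,x)\mapsto\psi_s(x)$ evaluated on $(\partial_s,0)$ at $s=0$. -/
theorem contMDiff_field (h : IsSmoothFlow V ψ) :
    ContMDiff (𝓡 2) (𝓡 2).tangent ∞ (fun x => (⟨x, V x⟩ : TangentBundle (𝓡 2) M)) := by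
  have h1 : ContMDiff (𝓘(ℝ, ℝ).prod (𝓡 2)).tangent (𝓡 2).tangent ∞
      (tangentMap (𝓘(ℝ, ℝ).prod (𝓡 2)) (𝓡 2) fun z : ℝ × M => ψ z.1 z.2) :=
    h.smooth.contMDiff_tangentMap (by simp)
  have h2 : ContMDiff (𝓡 2) (𝓘(ℝ, ℝ).tangent.prod (𝓡 2).tangent) ∞ fun x : M =>
      ((⟨(0 : ℝ), (1 : ℝ)⟩ : TangentBundle 𝓘(ℝ, ℝ) ℝ),
        (TotalSpace.mk' (EuclideanSpace ℝ (Fin 2)) x 0 : TangentBundle (𝓡 2) M)) :=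
    contMDiff_const.prodMk (contMDiff_zeroSection ℝ (TangentSpace (𝓡 2) : M → Type _))
  have h3 := h1.comp (contMDiff_equivTangentBundleProd_symm.comp h2)
  convert! h3 using 1
  ext1 x
  have e := h.mfderiv_uncurry 0 x 1 0
  simp only [map_zero, add_zero, one_smul] at e
  have key : ∀ (x' : M), x = x' → ∀ w : EuclideanSpace ℝ (Fin 2), w = V x' →
      (⟨x, V x⟩ : TangentBundle (𝓡 2) M) = ⟨x', w⟩ := by
    rintro _ rfl w rfl; rfl
  exact key _ (h.zero x).symm _ e

theorem eq_of_isMIntegralCurve (h : IsSmoothFlow V ψ) {c : ℝ → M}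
    (hc : IsMIntegralCurve (I := 𝓡 2) c V) (s : ℝ) : ψ s (c 0) = c s := by
  have := isMIntegralCurve_Ioo_eq_of_contMDiff_boundaryless (t₀ := 0)
    (h.contMDiff_field.of_le (by simp)) (h.integralCurve (c 0)) hc (h.zero _)
  exact congrFun this s

theorem add (h : IsSmoothFlow V ψ) (s t : ℝ) (x : M) : ψ (s + t) x = ψ s (ψ t x) := by
  have := h.eq_of_isMIntegralCurve ((h.integralCurve x).comp_add t) s
  simp only [Function.comp_apply, zero_add] at this
  exact this.symm

theorem neg_cancel (h : IsSmoothFlow V ψ) (s : ℝ) (x : M) : ψ (-s) (ψ s x) = x := by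
  rw [← h.add, neg_add_cancel, h.zero]

theorem cancel_neg (h : IsSmoothFlow V ψ) (s : ℝ) (x : M) : ψ s (ψ (-s) x) = x := by
  rw [← h.add, add_neg_cancel, h.zero]

/-- Differentiate $\psi_s\circ\psi_t=\psi_t\circ\psi_s$ in $t$ at $0$. -/
theorem mfderiv_apply_field (h : IsSmoothFlow V ψ) (s : ℝ) (x : M) :
    mfderiv (𝓡 2) (𝓡 2) (ψ s) x (V x) = V (ψ s x) := by
  have h1 : ∀ y, HasMFDerivAt 𝓘(ℝ, ℝ) (𝓡 2) (fun t => ψ t y) 0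
      ((1 : ℝ →L[ℝ] ℝ).smulRight (V (ψ 0 y))) := fun y => h.integralCurve y 0
  have h2 := (h.mdifferentiableAt_time s (ψ 0 x)).hasMFDerivAt.comp (0 : ℝ) (h1 x)
  have h3 : (ψ s ∘ fun t => ψ t x) = fun t => ψ t (ψ s x) := by
    ext1 t
    simp only [Function.comp_apply]
    rw [← h.add, ← h.add, add_comm]
  rw [h3] at h2
  have h4 := congrArg (fun (f : ℝ →L[ℝ] EuclideanSpace ℝ (Fin 2)) => f 1)
    (h2.mfderiv.symm.trans (h1 (ψ s x)).mfderiv)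
  have h5 : ∀ x₁ x₂ : M, x₁ = x → x₂ = ψ s x →
      mfderiv (𝓡 2) (𝓡 2) (ψ s) x₁ (V x₁) = (V x₂ : EuclideanSpace ℝ (Fin 2)) →
      mfderiv (𝓡 2) (𝓡 2) (ψ s) x (V x) = V (ψ s x) := by
    rintro _ _ rfl rfl h; exact h
  refine h5 (ψ 0 x) (ψ 0 (ψ s x)) (h.zero _) (h.zero _) ?_
  have e1 : ∀ y, ((1 : ℝ →L[ℝ] ℝ).smulRight (V y)) (1 : ℝ) = V y := fun y => by
    simp
  have h6 : mfderiv (𝓡 2) (𝓡 2) (ψ s) (ψ 0 x) (((1 : ℝ →L[ℝ] ℝ).smulRight (V (ψ 0 x))) (1 : ℝ)) =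
    (((1 : ℝ →L[ℝ] ℝ).smulRight (V (ψ 0 (ψ s x)))) (1 : ℝ) : EuclideanSpace ℝ (Fin 2)) := h4
  rw [e1, e1] at h6
  exact h6

end IsSmoothFlow

end Flow

/-! ### Transfer of reachability between two norm functions -/

section Transfer

variable {M : Type*} [MetricSpace M] [ChartedSpace (EuclideanSpace ℝ (Fin 2)) M]
  {F G : (x : M) → TangentSpace (𝓡 2) x → ℝ} {V : (x : M) → TangentSpace (𝓡 2) x} {ψ : ℝ → M → M}

theorem mdifferentiableAt_of_contMDiffOn_Icc {c : ℝ → M} {a b t : ℝ}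
    (hc : ContMDiffOn 𝓘(ℝ, ℝ) (𝓡 2) ∞ c (Icc a b)) (ht : t ∈ Ioo a b) :
    MDifferentiableAt 𝓘(ℝ, ℝ) (𝓡 2) c t :=
  (hc.contMDiffAt (Icc_mem_nhds ht.1 ht.2)).mdifferentiableAt (by simp)

theorem IsSmoothFlow.contMDiffOn_comp (h : IsSmoothFlow V ψ) {T : ℝ → ℝ} (hT : ContDiff ℝ ∞ T)
    {c : ℝ → M} {a b : ℝ} (hc : ContMDiffOn 𝓘(ℝ, ℝ) (𝓡 2) ∞ c (Icc a b)) :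
    ContMDiffOn 𝓘(ℝ, ℝ) (𝓡 2) ∞ (fun t => ψ (T t) (c t)) (Icc a b) :=
  h.smooth.comp_contMDiffOn (hT.contMDiff.contMDiffOn.prodMk hc)

theorem PiecewiseSmooth.refl (c : ℝ → M) (a : ℝ) : PiecewiseSmooth c a a :=
  ⟨0, fun _ => a, monotone_const, rfl, rfl, fun i hi => absurd hi (Nat.not_lt_zero i)⟩

theorem Reach.refl (x : M) : Reach F x x 0 :=
  ⟨fun _ => x, 0, 0, le_rfl, .refl _ _, rfl, rfl, by simp [length]⟩

theorem Reach.mono {x y : M} {L L' : ℝ} (h : Reach F x y L) (hL : L ≤ L') : Reach F x y L' := by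
  obtain ⟨σ, a, b, hab, hσ, ha, hb, hl⟩ := h
  exact ⟨σ, a, b, hab, hσ, ha, hb, hl.trans hL⟩

variable [IsManifold (𝓡 2) ∞ M]

/-- The flow `ψ` of `V` is a family of `G`-isometries and carries a motion of `F`-speed at most one
to a motion of `G`-speed at most one. -/
structure Transfers (F G : (x : M) → TangentSpace (𝓡 2) x → ℝ)
    (V : (x : M) → TangentSpace (𝓡 2) x) (ψ : ℝ → M → M) : Prop where
  flow : IsSmoothFlow V ψ
  continuous_left : Continuous fun v : TangentBundle (𝓡 2) M => F v.1 v.2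
  continuous_right : Continuous fun v : TangentBundle (𝓡 2) M => G v.1 v.2
  le_of_le : ∀ (s : ℝ) (x : M) (y : TangentSpace (𝓡 2) x) (τ : ℝ), F x y ≤ τ →
    G (ψ s x) (τ • V (ψ s x) + mfderiv (𝓡 2) (𝓡 2) (ψ s) x y) ≤ τ
  eq_one : ∀ (s : ℝ) (x : M) (y : TangentSpace (𝓡 2) x), F x y = 1 →
    G (ψ s x) (V (ψ s x) + mfderiv (𝓡 2) (𝓡 2) (ψ s) x y) = 1
  isometry : ∀ (s : ℝ) (x : M) (y : TangentSpace (𝓡 2) x),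
    G (ψ s x) (mfderiv (𝓡 2) (𝓡 2) (ψ s) x y) = G x y
  field_lt_one : ∀ x, G x (V x) < 1

/-- Statements that add up along concatenation need only be checked on one nondegenerate smooth
piece; empty pieces, which the monotone partition allows, are covered by `refl`. -/
theorem PiecewiseSmooth.induction {R : M → M → ℝ → Prop}
    (hF : Continuous fun v : TangentBundle (𝓡 2) M => F v.1 v.2)
    (refl : ∀ x, R x x 0) (trans : ∀ x y z L L', R x y L → R y z L' → R x z (L + L'))
    (piece : ∀ (c : ℝ → M) (a b : ℝ), a < b → ContMDiffOn 𝓘(ℝ, ℝ) (𝓡 2) ∞ c (Icc a b) →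
      R (c a) (c b) (length F c a b)) {c : ℝ → M} {a b : ℝ} (h : PiecewiseSmooth c a b) :
    R (c a) (c b) (length F c a b) := by
  obtain ⟨n, t, ht, rfl, rfl, hs⟩ := h
  induction n with
  | zero => simpa [length] using refl (c (t 0))
  | succ n ih =>
    have h1 := ih fun i hi => hs i (hi.trans (Nat.lt_succ_self n))
    have hn := hs n (Nat.lt_succ_self n)
    have hle := ht (Nat.le_succ n)
    have hadd : length F c (t 0) (t (n + 1)) =
        length F c (t 0) (t n) + length F c (t n) (t (n + 1)) :=
      (intervalIntegral.integral_add_adjacent_intervals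
        (PiecewiseSmooth.intervalIntegrable hF ⟨n, t, ht, rfl, rfl,
          fun i hi => hs i (hi.trans (Nat.lt_succ_self n))⟩)
        (intervalIntegrable_of_contMDiffOn hF hle hn)).symm
    rw [hadd]
    refine trans _ _ _ _ _ h1 ?_
    rcases hle.eq_or_lt with heq | hlt
    · rw [Nat.succ_eq_add_one] at heq
      rw [← heq]; simpa [length] using refl (c (t n))
    · exact piece c _ _ hlt hn

theorem reach_of_contMDiffOn (hF : Continuous fun v : TangentBundle (𝓡 2) M => F v.1 v.2)
    {c : ℝ → M} {a b : ℝ} (hab : a ≤ b) (hc : ContMDiffOn 𝓘(ℝ, ℝ) (𝓡 2) ∞ c (Icc a b)) {g : ℝ → ℝ}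
    (hg : IntervalIntegrable g volume a b) (h : ∀ t ∈ Ioo a b, F (c t) (velocity c t) ≤ g t) :
    Reach F (c a) (c b) (∫ t in a..b, g t) :=
  ⟨c, a, b, hab, .of_contMDiffOn hab hc, rfl, rfl, intervalIntegral.integral_mono_on_of_le_Ioo hab
    (intervalIntegrable_of_contMDiffOn hF hab hc) hg h⟩

namespace Transfers

theorem reach_flow (H : Transfers F G V ψ) {x y : M} {L : ℝ} (h : Reach G x y L) (s : ℝ) :
    Reach G (ψ s x) (ψ s y) L := by
  obtain ⟨σ, a, b, hab, hσ, rfl, rfl, hL⟩ := h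
  refine Reach.mono ?_ hL
  refine hσ.induction (R := fun x y L => Reach G (ψ s x) (ψ s y) L) H.continuous_right
    (fun _ => .refl _) (fun x y z L L' h h' => h.trans H.continuous_right h') ?_
  intro c a b hab hc
  refine reach_of_contMDiffOn H.continuous_right hab.le (c := fun t => ψ s (c t))
    (H.flow.contMDiffOn_comp contDiff_const hc)
    (intervalIntegrable_of_contMDiffOn H.continuous_right hab.le hc) fun t ht => ?_
  rw [H.flow.velocity_comp (hasDerivAt_const t s) (mdifferentiableAt_of_contMDiffOn_Icc hc ht),
    zero_smul, zero_add, H.isometry]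

/-- Ideally the clock `T` would be the `F`-arclength, but the speed may vanish and its arclength
need not be smooth. A polynomial slightly larger than the speed is integrated instead, at the cost
of `ε`. Pieces concatenate because $\psi_s$ preserves `G`-reachability. -/
theorem exists_reach (H : Transfers F G V ψ) {x y : M} {L : ℝ} (h : Reach F x y L) {ε : ℝ}
    (hε : 0 < ε) : ∃ s ≤ L + ε, Reach G x (ψ s y) s := by
  obtain ⟨σ, a, b, hab, hσ, rfl, rfl, hL⟩ := h
  suffices ∃ s ≤ length F σ a b + ε, Reach G (σ a) (ψ s (σ b)) s by
    obtain ⟨s, hs, hs'⟩ := this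
    exact ⟨s, by linarith, hs'⟩
  revert ε
  refine hσ.induction (R := fun x y L => ∀ {ε : ℝ}, 0 < ε → ∃ s ≤ L + ε, Reach G x (ψ s y) s)
    H.continuous_left (fun x ε hε => ⟨0, by linarith, ?_⟩) ?_ ?_
  · rw [H.flow.zero]; exact .refl x
  · intro x y z L L' h h' ε hε
    obtain ⟨s, hs, hr⟩ := h (half_pos hε)
    obtain ⟨s', hs', hr'⟩ := h' (half_pos hε)
    refine ⟨s + s', by linarith, ?_⟩
    rw [H.flow.add]
    exact hr.trans H.continuous_right (H.reach_flow hr' s)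
  · intro c a b hab hc ε hε
    obtain ⟨g, hg, hgF⟩ := exists_continuousOn_eval_velocity H.continuous_left hab hc
    have hba : 0 < b - a := sub_pos.2 hab
    -- Approximating `g + δ` within `δ` puts `T'` between `g` and `g + 2δ`, so the total excess is
    -- at most $2\delta(b-a)=\varepsilon$.
    set δ := ε / (2 * (b - a)) with hδ
    have hδ0 : 0 < δ := by positivity
    obtain ⟨P, hP⟩ := exists_polynomial_near_of_continuousOn a b (fun t => g t + δ)
      (hg.add continuousOn_const) δ hδ0
    have hQc : Continuous fun t : ℝ => P.eval t := P.continuous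
    set T : ℝ → ℝ := fun t => ∫ r in a..t, P.eval r with hT
    have hTd : ∀ t, HasDerivAt T (P.eval t) t := fun t => hQc.integral_hasStrictDerivAt a t
      |>.hasDerivAt
    have hTs : ContDiff ℝ ∞ T := by
      rw [contDiff_infty_iff_deriv]
      refine ⟨fun t => (hTd t).differentiableAt, ?_⟩
      rw [show deriv T = fun t => P.eval t from funext fun t => (hTd t).deriv]
      simpa using P.contDiff_aeval (𝕜 := ℝ) ∞
    have hgi : IntervalIntegrable g volume a b := by
      apply ContinuousOn.intervalIntegrable; rwa [uIcc_of_le hab.le]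
    have hlen : length F c a b = ∫ t in a..b, g t := by
      unfold length
      rw [intervalIntegral.integral_of_le hab.le, intervalIntegral.integral_of_le hab.le,
        integral_Ioc_eq_integral_Ioo, integral_Ioc_eq_integral_Ioo]
      exact setIntegral_congr_fun measurableSet_Ioo hgF
    refine ⟨T b, ?_, ?_⟩
    · have h1 : T b ≤ ∫ t in a..b, (g t + 2 * δ) := by
        refine intervalIntegral.integral_mono_on hab.le (hQc.intervalIntegrable _ _)
          (hgi.add intervalIntegrable_const) fun t ht => ?_
        have := (abs_lt.1 (hP t ht)).2
        linarith
      rw [intervalIntegral.integral_add hgi intervalIntegrable_const,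
        intervalIntegral.integral_const, ← hlen, smul_eq_mul] at h1
      have : (b - a) * (2 * δ) = ε := by rw [hδ]; field_simp
      linarith
    · have h1 := reach_of_contMDiffOn H.continuous_right hab.le (c := fun t => ψ (T t) (c t))
        (H.flow.contMDiffOn_comp hTs hc) (hQc.intervalIntegrable a b) fun t ht => by
          rw [H.flow.velocity_comp (hTd t) (mdifferentiableAt_of_contMDiffOn_Icc hc ht)]
          refine H.le_of_le _ _ _ _ ?_
          rw [hgF t ht]
          have := (abs_lt.1 (hP t (Ioo_subset_Icc_self ht))).1
          linarith
      have h2 : T a = 0 := by simp [hT]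
      rw [h2, H.flow.zero] at h1
      exact h1

/-- Drifting has constant `G`-speed $G(x,V(x))<1$, since $\psi_t$ preserves both `G` and `V`. -/
theorem exists_reach_flow_lt (H : Transfers F G V ψ) (x : M) {s : ℝ} (hs : 0 < s) :
    ∃ L < s, Reach G x (ψ s x) L := by
  have hc : ContMDiffOn 𝓘(ℝ, ℝ) (𝓡 2) ∞ (fun t => ψ t x) (Icc 0 s) :=
    (H.flow.smooth.comp (contMDiff_id.prodMk contMDiff_const)).contMDiffOn
  have hv : ∀ t, G (ψ t x) (velocity (fun t => ψ t x) t) = G x (V x) := fun t => by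
    have : velocity (fun t => ψ t x) t = V (ψ t x) := by
      have h1 := (H.flow.integralCurve x t).mfderiv
      have h2 : ((1 : ℝ →L[ℝ] ℝ).smulRight (V (ψ t x))) (1 : ℝ) = V (ψ t x) := by simp
      unfold velocity
      rw [h1]; exact h2
    rw [this, ← H.flow.mfderiv_apply_field, H.isometry]
  have h1 := reach_of_contMDiffOn H.continuous_right hs.le hc
    (intervalIntegrable_const (c := G x (V x))) fun t _ => (hv t).le
  rw [H.flow.zero] at h1
  refine ⟨_, ?_, h1⟩
  rw [intervalIntegral.integral_const, smul_eq_mul, sub_zero]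
  exact mul_lt_of_lt_one_right hs (H.field_lt_one x)

theorem isMinimizing (H : Transfers F G V ψ) {c : ℝ → M} {u v : ℝ}
    (hF : length F c u v = v - u) (hG : length G (fun s => ψ s (c s)) u v = v - u)
    (hmin : IsMinimizing G (fun s => ψ s (c s)) u v) : IsMinimizing F c u v := by
  rw [isMinimizing_iff_reach] at hmin ⊢
  intro L hL
  by_contra! hlt
  rw [hF] at hlt
  -- Half of the gap absorbs the approximation error, leaving `s < v - u`; the rest of the time is
  -- spent drifting.
  obtain ⟨s, hs, hr⟩ := H.exists_reach hL (half_pos (sub_pos.2 hlt))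
  have hs' : 0 < v - u - s := by linarith
  have h1 := H.reach_flow hr u
  obtain ⟨L', hL', hr'⟩ := H.exists_reach_flow_lt (ψ u (ψ s (c v))) hs'
  rw [← H.flow.add, ← H.flow.add, show v - u - s + (u + s) = v by ring] at hr'
  rw [← H.flow.add] at h1
  have := hmin _ (h1.trans H.continuous_right hr')
  rw [hG] at this
  linarith

end Transfers

end Transfer

/-! ### Transfer of geodesics and cut points -/

section Geodesics

variable {M : Type*} [MetricSpace M] [ChartedSpace (EuclideanSpace ℝ (Fin 2)) M]
  {F G : (x : M) → TangentSpace (𝓡 2) x → ℝ} {V V' : (x : M) → TangentSpace (𝓡 2) x}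
  {ψ ψ' : ℝ → M → M}

theorem length_eq_sub_of_unit_speed {c : ℝ → M} {a b u v : ℝ}
    (h : ∀ t ∈ Ioo a b, F (c t) (velocity c t) = 1) (hu : a ≤ u) (huv : u ≤ v) (hv : v ≤ b) :
    length F c u v = v - u := by
  unfold length
  rw [intervalIntegral.integral_of_le huv, integral_Ioc_eq_integral_Ioo,
    setIntegral_congr_fun (g := fun _ => (1 : ℝ)) measurableSet_Ioo
      fun t ht => h t ⟨hu.trans_lt ht.1, ht.2.trans_le hv⟩]
  simp [huv]

variable [IsManifold (𝓡 2) ∞ M]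

namespace Transfers

theorem unit_speed (H : Transfers F G V ψ) {c : ℝ → M} {a b : ℝ}
    (hc : ContMDiffOn 𝓘(ℝ, ℝ) (𝓡 2) ∞ c (Icc a b))
    (h : ∀ t ∈ Ioo a b, F (c t) (velocity c t) = 1) :
    ∀ t ∈ Ioo a b, G (ψ t (c t)) (velocity (fun s => ψ s (c s)) t) = 1 := fun t ht => by
  rw [H.flow.velocity_comp (hasDerivAt_id' t) (mdifferentiableAt_of_contMDiffOn_Icc hc ht),
    one_smul]
  exact H.eq_one _ _ _ (h t ht)

/-- `Transfers.isMinimizing` works backwards, so it is applied to the inverse transfer and the image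
curve, whose pullback is `c`. -/
theorem isMinimizing_image (H : Transfers F G V ψ) (H' : Transfers G F V' ψ')
    (hψ : ∀ s x, ψ' s (ψ s x) = x) {c : ℝ → M} {a b u v : ℝ}
    (hc : ContMDiffOn 𝓘(ℝ, ℝ) (𝓡 2) ∞ c (Icc a b))
    (h : ∀ t ∈ Ioo a b, F (c t) (velocity c t) = 1) (hu : a ≤ u) (huv : u ≤ v) (hv : v ≤ b)
    (hmin : IsMinimizing F c u v) : IsMinimizing G (fun s => ψ s (c s)) u v := by
  apply H'.isMinimizing
  · exact length_eq_sub_of_unit_speed (H.unit_speed hc h) hu huv hv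
  · simp only [hψ]; exact length_eq_sub_of_unit_speed h hu huv hv
  · simpa only [hψ] using hmin

theorem isUnitGeodesic (H : Transfers F G V ψ) (H' : Transfers G F V' ψ')
    (hψ : ∀ s x, ψ' s (ψ s x) = x) {c : ℝ → M} {a b : ℝ} (hc : IsUnitGeodesic F c a b) :
    IsUnitGeodesic G (fun s => ψ s (c s)) a b where
  smooth := H.flow.contMDiffOn_comp contDiff_id hc.smooth
  unit_speed := H.unit_speed hc.smooth hc.unit_speed
  locally_minimizing t ht := by
    obtain ⟨ε, hε, h⟩ := hc.locally_minimizing t ht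
    exact ⟨ε, hε, fun u hu v hv hut hvt huv => H.isMinimizing_image H' hψ hc.smooth hc.unit_speed
      hu.1 huv hv.2 (h u hu v hv hut hvt huv)⟩

theorem isCutPoint (H : Transfers F G V ψ) (H' : Transfers G F V' ψ')
    (hψ : ∀ s x, ψ' s (ψ s x) = x) (hψ' : ∀ s x, ψ s (ψ' s x) = x) {x : M} {c : ℝ → M} {l : ℝ}
    (hc : IsCutPoint F x c l) : IsCutPoint G x (fun s => ψ s (c s)) l where
  pos := hc.pos
  start := by rw [H.flow.zero, hc.start]
  geodesic := H.isUnitGeodesic H' hψ hc.geodesic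
  minimizing := H.isMinimizing_image H' hψ hc.geodesic.smooth hc.geodesic.unit_speed le_rfl
    hc.pos.le le_rfl hc.minimizing
  not_minimizing_beyond t₁ c' ht₁ hc' hgeo hmin := by
    refine hc.not_minimizing_beyond t₁ (fun s => ψ' s (c' s)) ht₁ (fun s hs => ?_)
      (H'.isUnitGeodesic H hψ' hgeo) ?_
    · simp only [hc' hs, hψ]
    · exact H'.isMinimizing_image H hψ' hgeo.smooth hgeo.unit_speed le_rfl
        (hc.pos.trans ht₁).le le_rfl hmin

end Transfers

end Geodesics

/-! ### The Randers norm on one tangent space -/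

section Randers

variable {E : Type*} [NormedAddCommGroup E] [InnerProductSpace ℝ E]

theorem norm_sub_smul_sq (w y : E) (τ : ℝ) :
    ‖y - τ • w‖ ^ 2 = ‖y‖ ^ 2 - 2 * τ * inner ℝ w y + τ ^ 2 * ‖w‖ ^ 2 := by
  rw [norm_sub_sq_real, norm_smul, mul_pow, Real.norm_eq_abs, sq_abs, real_inner_smul_right,
    real_inner_comm]
  ring

/-- With $\lambda=1-\|w\|^2$ and $b=\langle w,y\rangle$, squaring $\|y-\tau w\|\le\tau$ gives
$\|y\|^2\le\lambda\tau^2+2b\tau$; the Randers value is the nonnegative root of the corresponding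
quadratic. -/
theorem randers_le_iff {w : E} (hw : ‖w‖ < 1) (y : E) (τ : ℝ) :
    Real.sqrt ((1 - ‖w‖ ^ 2) * ‖y‖ ^ 2 + (inner ℝ w y) ^ 2) / (1 - ‖w‖ ^ 2)
      - inner ℝ w y / (1 - ‖w‖ ^ 2) ≤ τ ↔ ‖y - τ • w‖ ≤ τ := by
  have hl : 0 < 1 - ‖w‖ ^ 2 := by nlinarith [norm_nonneg w]
  set b : ℝ := inner ℝ w y
  have hn := norm_sub_smul_sq w y τ
  rw [← sub_div, div_le_iff₀ hl, sub_le_iff_le_add]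
  constructor
  · intro h
    have h0 : |b| ≤ Real.sqrt ((1 - ‖w‖ ^ 2) * ‖y‖ ^ 2 + b ^ 2) := by
      apply Real.abs_le_sqrt
      have : 0 ≤ (1 - ‖w‖ ^ 2) * ‖y‖ ^ 2 := by positivity
      linarith
    have h1 : 0 ≤ τ := by
      have : 0 ≤ τ * (1 - ‖w‖ ^ 2) := by linarith [le_abs_self b]
      exact nonneg_of_mul_nonneg_left this hl
    have h2 := (Real.sqrt_le_left ((abs_nonneg b).trans (h0.trans h))).1 h
    refine abs_le_of_sq_le_sq' ?_ h1 |>.2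
    rw [hn]
    have : (1 - ‖w‖ ^ 2) * (‖y‖ ^ 2 - 2 * τ * b + τ ^ 2 * ‖w‖ ^ 2) ≤ (1 - ‖w‖ ^ 2) * τ ^ 2 := by
      nlinarith
    exact le_of_mul_le_mul_left this hl
  · intro h
    have h1 : 0 ≤ τ := (norm_nonneg _).trans h
    have h2 : ‖y‖ ^ 2 - 2 * τ * b + τ ^ 2 * ‖w‖ ^ 2 ≤ τ ^ 2 := by
      rw [← hn]; exact pow_le_pow_left₀ (norm_nonneg _) h 2
    -- This sign is needed to take the square root; it is the average of $\lambda\tau+2b\ge0$ and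
    -- $\lambda\tau\ge0$.
    have h3 : 0 ≤ τ * (1 - ‖w‖ ^ 2) + b := by
      rcases h1.eq_or_lt with rfl | h1
      · have : y = 0 := by simpa using h
        simp [b, this]
      · have h4 : 0 ≤ τ * (τ * (1 - ‖w‖ ^ 2) + 2 * b) := by nlinarith [sq_nonneg ‖y‖]
        have h5 : 0 ≤ τ * (1 - ‖w‖ ^ 2) + 2 * b := nonneg_of_mul_nonneg_right h4 h1
        have h6 : 0 ≤ τ * (1 - ‖w‖ ^ 2) := by positivity
        linarith
    refine Real.sqrt_le_iff.2 ⟨h3, ?_⟩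
    have := mul_le_mul_of_nonneg_left h2 hl.le
    nlinarith

theorem randers_eq_one_iff {w : E} (hw : ‖w‖ < 1) (y : E) :
    Real.sqrt ((1 - ‖w‖ ^ 2) * ‖y‖ ^ 2 + (inner ℝ w y) ^ 2) / (1 - ‖w‖ ^ 2)
      - inner ℝ w y / (1 - ‖w‖ ^ 2) = 1 ↔ ‖y - w‖ = 1 := by
  have hl : 0 < 1 - ‖w‖ ^ 2 := by nlinarith [norm_nonneg w]
  have hn := norm_sub_smul_sq w y 1
  rw [one_smul] at hn
  constructor
  · intro h
    rw [← sub_div, div_eq_one_iff_eq hl.ne', sub_eq_iff_eq_add] at h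
    have h0 : (1 - ‖w‖ ^ 2) * ‖y‖ ^ 2 + (inner ℝ w y) ^ 2 =
        (1 - ‖w‖ ^ 2 + inner ℝ w y) ^ 2 := by
      rw [← h, Real.sq_sqrt (by positivity)]
    have h1 : (1 - ‖w‖ ^ 2) * (‖y - w‖ ^ 2) = (1 - ‖w‖ ^ 2) * 1 := by
      rw [hn]; nlinarith
    have h2 := mul_left_cancel₀ hl.ne' h1
    exact (pow_eq_one_iff_of_nonneg (norm_nonneg _) two_ne_zero).1 h2
  · intro h
    have h0 : ‖y - (1 : ℝ) • w‖ ≤ 1 := by rw [one_smul, h]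
    refine le_antisymm ((randers_le_iff hw y 1).2 h0) ?_
    rw [← sub_div, le_div_iff₀ hl, one_mul, le_sub_iff_add_le]
    rw [h] at hn
    refine Real.le_sqrt_of_sq_le ?_
    nlinarith

theorem randers_self_lt_one {w : E} (hw : ‖w‖ < 1) :
    Real.sqrt ((1 - ‖w‖ ^ 2) * ‖w‖ ^ 2 + (inner ℝ w w) ^ 2) / (1 - ‖w‖ ^ 2)
      - inner ℝ w w / (1 - ‖w‖ ^ 2) < 1 := by
  refine lt_of_le_of_lt ((randers_le_iff hw w ‖w‖).2 ?_) hw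
  have : w - ‖w‖ • w = (1 - ‖w‖) • w := by rw [sub_smul, one_smul]
  rw [this, norm_smul, Real.norm_eq_abs, abs_of_nonneg (by linarith)]
  nlinarith [norm_nonneg w]

end Randers

/-! ### The two transfers between the Riemannian and the Randers metric -/

section Navigation

variable {M : Type*} [MetricSpace M] [ChartedSpace (EuclideanSpace ℝ (Fin 2)) M]
  [RiemannianBundle (fun x : M => TangentSpace (𝓡 2) x)]
  {W : (x : M) → TangentSpace (𝓡 2) x} {φ : ℝ → M → M}

theorem inner_mfderiv_eq {f : M → M} {x : M}
    (hf : ∀ v : TangentSpace (𝓡 2) x, ‖mfderiv (𝓡 2) (𝓡 2) f x v‖ = ‖v‖)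
    (v w : TangentSpace (𝓡 2) x) :
    inner ℝ (mfderiv (𝓡 2) (𝓡 2) f x v) (mfderiv (𝓡 2) (𝓡 2) f x w) = inner ℝ v w := by
  rw [real_inner_eq_norm_add_mul_self_sub_norm_mul_self_sub_norm_mul_self_div_two,
    real_inner_eq_norm_add_mul_self_sub_norm_mul_self_sub_norm_mul_self_div_two,
    ← map_add, hf, hf, hf]

variable [IsManifold (𝓡 2) ∞ M]
  [IsContMDiffRiemannianBundle (𝓡 2) ∞ (EuclideanSpace ℝ (Fin 2))
    (fun x : M => TangentSpace (𝓡 2) x)]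

/-- A smooth Riemannian metric is continuous. -/
theorem isContinuousRiemannianBundle_tangent : IsContinuousRiemannianBundle
    (EuclideanSpace ℝ (Fin 2)) (fun x : M => TangentSpace (𝓡 2) x) := by
  obtain ⟨g, hg, h⟩ := IsContMDiffRiemannianBundle.exists_contMDiff (IB := 𝓡 2) (n := ∞)
    (F := EuclideanSpace ℝ (Fin 2)) (E := fun x : M => TangentSpace (𝓡 2) x)
  exact ⟨g, hg.continuous, h⟩

theorem continuous_hNorm :
    Continuous fun v : TangentBundle (𝓡 2) M => hNorm v.1 v.2 := by
  have := isContinuousRiemannianBundle_tangent (M := M)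
  have h : Continuous fun v : TangentBundle (𝓡 2) M => inner ℝ v.2 v.2 :=
    Continuous.inner_bundle (F := EuclideanSpace ℝ (Fin 2)) (E := fun x : M => TangentSpace (𝓡 2) x)
      (b := fun v : TangentBundle (𝓡 2) M => v.1) (v := fun v => v.2) (w := fun v => v.2) continuous_id continuous_id
  have : (fun v : TangentBundle (𝓡 2) M => hNorm v.1 v.2) =
      fun v => Real.sqrt (inner ℝ v.2 v.2) := by
    funext v; exact norm_eq_sqrt_real_inner v.2
  rw [this]
  exact h.sqrt

theorem continuous_randers (hW : Continuous fun x => (⟨x, W x⟩ : TangentBundle (𝓡 2) M))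
    (hlt : ∀ x, ‖W x‖ < 1) :
    Continuous fun v : TangentBundle (𝓡 2) M => randers W v.1 v.2 := by
  have := isContinuousRiemannianBundle_tangent (M := M)
  have h1 : Continuous fun v : TangentBundle (𝓡 2) M => inner ℝ (W v.1) v.2 :=
    Continuous.inner_bundle (F := EuclideanSpace ℝ (Fin 2)) (E := fun x : M => TangentSpace (𝓡 2) x)
      (b := fun v : TangentBundle (𝓡 2) M => v.1) (v := fun v => W v.1) (w := fun v => v.2)
      (hW.comp (FiberBundle.continuous_proj _ _)) continuous_id
  have h2 : Continuous fun v : TangentBundle (𝓡 2) M => ‖v.2‖ := continuous_hNorm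
  have h3 : Continuous fun v : TangentBundle (𝓡 2) M => ‖W v.1‖ :=
    continuous_hNorm.comp (hW.comp (FiberBundle.continuous_proj _ _))
  have hl : ∀ v : TangentBundle (𝓡 2) M, 1 - ‖W v.1‖ ^ 2 ≠ 0 := fun v => by
    have := hlt v.1
    nlinarith [norm_nonneg (W v.1)]
  unfold randers
  exact ((((continuous_const.sub (h3.pow 2)).mul (h2.pow 2)).add (h1.pow 2)).sqrt.div
    (continuous_const.sub (h3.pow 2)) hl).sub (h1.div (continuous_const.sub (h3.pow 2)) hl)

theorem transfers_hNorm_randers (hφ : IsSmoothFlow W φ) (hlt : ∀ x, ‖W x‖ < 1)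
    (hiso : ∀ s, PreservesMetric (φ s)) : Transfers hNorm (randers W) W φ where
  flow := hφ
  continuous_left := continuous_hNorm
  continuous_right := continuous_randers hφ.contMDiff_field.continuous hlt
  le_of_le s x y τ h := by
    refine (randers_le_iff (hlt _) _ _).2 ?_
    rw [add_sub_cancel_left, hiso s x y]
    exact h
  eq_one s x y h := by
    refine (randers_eq_one_iff (hlt _) _).2 ?_
    rw [add_sub_cancel_left, hiso s x y]
    exact h
  isometry s x y := by
    unfold randers
    rw [← hφ.mfderiv_apply_field, hiso s, hiso s, inner_mfderiv_eq (hiso s x)]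
  field_lt_one x := randers_self_lt_one (hlt x)

theorem transfers_randers_hNorm (hφ : IsSmoothFlow W φ) (hlt : ∀ x, ‖W x‖ < 1)
    (hiso : ∀ s, PreservesMetric (φ s)) :
    Transfers (randers W) hNorm (fun x => -W x) (fun s => φ (-s)) where
  flow := hφ.reverse
  continuous_left := continuous_randers hφ.contMDiff_field.continuous hlt
  continuous_right := continuous_hNorm
  le_of_le s x y τ h := by
    have := (randers_le_iff (hlt x) y τ).1 h
    unfold hNorm
    rw [← hφ.mfderiv_apply_field, ← map_neg, ← map_smul, ← map_add, hiso, smul_neg,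
      neg_add_eq_sub]
    exact this
  eq_one s x y h := by
    have := (randers_eq_one_iff (hlt x) y).1 h
    unfold hNorm
    rw [← hφ.mfderiv_apply_field, ← map_neg, ← map_add, hiso, neg_add_eq_sub]
    exact this
  isometry s x y := hiso (-s) x y
  field_lt_one x := by
    unfold hNorm
    rw [norm_neg]; exact hlt x

end Navigation

/-! ### Local lifts of curves through an immersion of the plane -/

section Lifting

variable {M : Type*} [MetricSpace M] [ChartedSpace (EuclideanSpace ℝ (Fin 2)) M]
  [IsManifold (𝓡 2) ∞ M]

/-- Read in a chart, `Φ` has an injective, hence bijective, derivative at `z`, so the inverse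
function theorem applies. A $C^1$ lift is enough for the later use. -/
theorem exists_contDiffAt_lift {Φ : ℝ × ℝ → M} {z : ℝ × ℝ}
    (hΦ : ContMDiffAt 𝓘(ℝ, ℝ × ℝ) (𝓡 2) ∞ Φ z)
    (hinj : Function.Injective (mfderiv 𝓘(ℝ, ℝ × ℝ) (𝓡 2) Φ z)) {c : ℝ → M} {r₀ : ℝ}
    (hc : ContMDiffAt 𝓘(ℝ, ℝ) (𝓡 2) ∞ c r₀) (h : c r₀ = Φ z) :
    ∃ ζ : ℝ → ℝ × ℝ, ζ r₀ = z ∧ ContDiffAt ℝ 1 ζ r₀ ∧ ∀ᶠ r in 𝓝 r₀, Φ (ζ r) = c r := by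
  set χ := extChartAt (𝓡 2) (Φ z) with hχ
  have hχs : ContMDiffAt (𝓡 2) 𝓘(ℝ, EuclideanSpace ℝ (Fin 2)) ∞ χ (Φ z) := contMDiffAt_extChartAt
  have hΨ : ContDiffAt ℝ ∞ (χ ∘ Φ) z := (hχs.comp z hΦ).contDiffAt
  have hχc : ContDiffAt ℝ ∞ (χ ∘ c) r₀ := by
    rw [← h] at hχs
    exact (hχs.comp r₀ hc).contDiffAt
  have hd : mfderiv 𝓘(ℝ, ℝ × ℝ) 𝓘(ℝ, EuclideanSpace ℝ (Fin 2)) (χ ∘ Φ) z =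
      (mfderiv (𝓡 2) 𝓘(ℝ, EuclideanSpace ℝ (Fin 2)) χ (Φ z)).comp
        (mfderiv 𝓘(ℝ, ℝ × ℝ) (𝓡 2) Φ z) :=
    mfderiv_comp z (hχs.mdifferentiableAt (by simp)) (hΦ.mdifferentiableAt (by simp))
  have hinj' : Function.Injective (fderiv ℝ (χ ∘ Φ) z) := by
    rw [← mfderiv_eq_fderiv, hd]
    exact (isInvertible_mfderiv_extChartAt (mem_extChartAt_source (Φ z))).injective.comp hinj
  have hdim : Module.finrank ℝ (ℝ × ℝ) = Module.finrank ℝ (EuclideanSpace ℝ (Fin 2)) := by simp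
  let e : (ℝ × ℝ) ≃L[ℝ] EuclideanSpace ℝ (Fin 2) :=
    (LinearEquiv.ofInjectiveOfFinrankEq
      (fderiv ℝ (χ ∘ Φ) z : (ℝ × ℝ) →ₗ[ℝ] EuclideanSpace ℝ (Fin 2)) hinj'
      hdim).toContinuousLinearEquiv
  have he : HasFDerivAt (χ ∘ Φ) (e : (ℝ × ℝ) →L[ℝ] EuclideanSpace ℝ (Fin 2)) z := by
    have : (e : (ℝ × ℝ) →L[ℝ] EuclideanSpace ℝ (Fin 2)) = fderiv ℝ (χ ∘ Φ) z := by
      ext1 <;> rfl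
    rw [this]
    exact (hΨ.differentiableAt (by simp)).hasFDerivAt
  have hΨ1 : ContDiffAt ℝ 1 (χ ∘ Φ) z := hΨ.of_le (by simp)
  set P := hΨ1.toOpenPartialHomeomorph (χ ∘ Φ) he one_ne_zero with hP
  have hPz : z ∈ P.source := hΨ1.mem_toOpenPartialHomeomorph_source he one_ne_zero
  have hPΨ : ∀ y, P y = χ (Φ y) := fun y => rfl
  have hval : (χ ∘ c) r₀ = P z := by rw [hPΨ, Function.comp_apply, h]
  have hsymm : ContDiffAt ℝ 1 P.symm (P z) := hΨ1.to_localInverse he one_ne_zero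
  have hζ : ContDiffAt ℝ 1 (P.symm ∘ (χ ∘ c)) r₀ := by
    refine ContDiffAt.comp r₀ ?_ (hχc.of_le (by simp))
    rw [hval]; exact hsymm
  have hζ0 : (P.symm ∘ (χ ∘ c)) r₀ = z := by
    rw [Function.comp_apply, hval, P.left_inv hPz]
  refine ⟨P.symm ∘ (χ ∘ c), hζ0, hζ, ?_⟩
  have h1 : ∀ᶠ r in 𝓝 r₀, (χ ∘ c) r ∈ P.target :=
    hχc.continuousAt.eventually_mem (by rw [hval]; exact P.open_target.mem_nhds (P.map_source hPz))
  have h2 : ∀ᶠ r in 𝓝 r₀, c r ∈ χ.source :=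
    hc.continuousAt.eventually_mem (by rw [h]; exact extChartAt_source_mem_nhds _)
  have h3 : ∀ᶠ r in 𝓝 r₀, Φ ((P.symm ∘ (χ ∘ c)) r) ∈ χ.source := by
    have : ContinuousAt (Φ ∘ (P.symm ∘ (χ ∘ c))) r₀ := by
      refine ContinuousAt.comp ?_ hζ.continuousAt
      rw [hζ0]; exact hΦ.continuousAt
    refine this.eventually_mem ?_
    rw [Function.comp_apply, hζ0]; exact extChartAt_source_mem_nhds _
  filter_upwards [h1, h2, h3] with r k1 k2 k3
  refine χ.injOn k3 k2 ?_
  rw [← hPΨ]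
  exact P.right_inv k1

end Lifting

/-! ### Riemannian distance, isometries and speed -/

section Distance

variable {M : Type*} [MetricSpace M] [ChartedSpace (EuclideanSpace ℝ (Fin 2)) M]

theorem velocity_comp {f : M → M} {c : ℝ → M} {t : ℝ}
    (hf : MDifferentiableAt (𝓡 2) (𝓡 2) f (c t)) (hc : MDifferentiableAt 𝓘(ℝ, ℝ) (𝓡 2) c t) :
    velocity (fun s => f (c s)) t = mfderiv (𝓡 2) (𝓡 2) f (c t) (velocity c t) := by
  unfold velocity
  exact congrArg (fun A : ℝ →L[ℝ] EuclideanSpace ℝ (Fin 2) => A 1) (mfderiv_comp t hf hc)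

variable [RiemannianBundle (fun x : M => TangentSpace (𝓡 2) x)]

section Isometry

variable [IsRiemannianManifold (𝓡 2) M]

theorem PreservesMetric.edist_le {f : M → M} (hf : PreservesMetric f)
    (hs : ContMDiff (𝓡 2) (𝓡 2) ∞ f) (x y : M) : edist (f x) (f y) ≤ edist x y := by
  rw [IsRiemannianManifold.out (I := 𝓡 2) x y, IsRiemannianManifold.out (I := 𝓡 2) (f x) (f y)]
  refine le_of_forall_gt fun r hr => ?_
  obtain ⟨c, h0, h1, hc, hlt⟩ := exists_lt_of_riemannianEDist_lt hr
  refine (riemannianEDist_le_pathELength (γ := fun t => f (c t)) (a := 0) (b := 1)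
    ((hs.of_le (by simp)).comp_contMDiffOn hc) (by simp [h0]) (by simp [h1])
    zero_le_one).trans_lt ?_
  refine lt_of_eq_of_lt ?_ hlt
  rw [pathELength_eq_lintegral_mfderiv_Ioo, pathELength_eq_lintegral_mfderiv_Ioo]
  refine setLIntegral_congr_fun measurableSet_Ioo fun t ht => ?_
  have hct : MDifferentiableAt 𝓘(ℝ, ℝ) (𝓡 2) c t :=
    (hc.contMDiffAt (Icc_mem_nhds ht.1 ht.2)).mdifferentiableAt one_ne_zero
  have := velocity_comp (hs.mdifferentiable (by simp) (c t)) hct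
  have h2 : ‖velocity (fun s => f (c s)) t‖ = ‖velocity c t‖ := by
    rw [this]; exact hf (c t) _
  change ‖velocity (fun s => f (c s)) t‖ₑ = ‖velocity c t‖ₑ
  rw [← ofReal_norm, ← ofReal_norm, h2]

theorem PreservesMetric.dist_eq {f : M ≃ₘ^∞⟮𝓡 2, 𝓡 2⟯ M} (hf : PreservesMetric f) (x y : M) :
    dist (f x) (f y) = dist x y := by
  have hs : PreservesMetric f.symm := by
    intro z v
    have h1 : mfderiv (𝓡 2) (𝓡 2) (f ∘ f.symm) z =
        (mfderiv (𝓡 2) (𝓡 2) f (f.symm z)).comp (mfderiv (𝓡 2) (𝓡 2) f.symm z) :=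
      mfderiv_comp z (f.mdifferentiable (by simp) _) (f.symm.mdifferentiable (by simp) _)
    have h2 : (f ∘ f.symm : M → M) = id := by ext1 w; simp
    have h3 := hf (f.symm z) (mfderiv (𝓡 2) (𝓡 2) f.symm z v)
    rw [← h3]
    have key : ∀ (g : M → M), g = id → ∀ w : TangentSpace (𝓡 2) (g z),
        w = mfderiv (𝓡 2) (𝓡 2) g z v → ‖w‖ = ‖v‖ := by
      rintro g rfl w rfl
      rw [mfderiv_id]; rfl
    exact key (f ∘ f.symm) h2 _ (by rw [h1]; rfl)
  have h1 := hf.edist_le f.contMDiff x y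
  have h2 := hs.edist_le f.symm.contMDiff (f x) (f y)
  simp only [Diffeomorph.symm_apply_apply] at h2
  rw [dist_edist, dist_edist, le_antisymm h1 h2]

end Isometry

variable [IsManifold (𝓡 2) ∞ M]
  [IsContMDiffRiemannianBundle (𝓡 2) ∞ (EuclideanSpace ℝ (Fin 2))
    (fun x : M => TangentSpace (𝓡 2) x)] [IsRiemannianManifold (𝓡 2) M]

theorem dist_le_length {c : ℝ → M} {a b : ℝ} (hab : a ≤ b)
    (hc : ContMDiffOn 𝓘(ℝ, ℝ) (𝓡 2) ∞ c (Icc a b)) : dist (c a) (c b) ≤ length hNorm c a b := by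
  have h1 : edist (c a) (c b) ≤ pathELength (𝓡 2) c a b := by
    rw [IsRiemannianManifold.out (I := 𝓡 2)]
    exact riemannianEDist_le_pathELength (hc.of_le (by simp)) rfl rfl hab
  have hi := intervalIntegrable_of_contMDiffOn (F := hNorm) continuous_hNorm hab hc
  rw [intervalIntegrable_iff_integrableOn_Ioo_of_le hab] at hi
  have h2 : pathELength (𝓡 2) c a b = ENNReal.ofReal (length hNorm c a b) := by
    unfold length
    rw [pathELength_eq_lintegral_mfderiv_Ioo, intervalIntegral.integral_of_le hab,
      integral_Ioc_eq_integral_Ioo, ofReal_integral_eq_lintegral_ofReal hi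
        (ae_of_all _ fun t => norm_nonneg _)]
    refine lintegral_congr fun t => ?_
    unfold hNorm velocity
    rw [ofReal_norm]; rfl
  rw [h2, edist_dist] at h1
  exact (ENNReal.ofReal_le_ofReal_iff (intervalIntegral.integral_nonneg hab
    fun t _ => norm_nonneg _)).1 h1

/-- If the speed at `0` were below some `k < 1`, continuity would make a short arc up to time `s`
have length at most `k * s`, less than the distance it must cover. -/
theorem one_le_norm_velocity {c : ℝ → M} {δ : ℝ} (hδ : 0 < δ)
    (hc : ContMDiffOn 𝓘(ℝ, ℝ) (𝓡 2) ∞ c (Icc (-δ) δ))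
    (h : ∀ s ∈ Ioo 0 δ, s ≤ dist (c 0) (c s)) : 1 ≤ ‖velocity c 0‖ := by
  obtain ⟨g, hg, hgc⟩ := exists_continuousOn_eval_velocity (F := hNorm) continuous_hNorm
    (by linarith : -δ < δ) hc
  have h0 : (0 : ℝ) ∈ Ioo (-δ) δ := ⟨by linarith, hδ⟩
  change 1 ≤ hNorm (c 0) (velocity c 0)
  rw [hgc 0 h0]
  by_contra! hlt
  obtain ⟨k, hk0, hk1⟩ := exists_between hlt
  have hgc0 : ContinuousAt g 0 := hg.continuousAt (Icc_mem_nhds h0.1 h0.2)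
  obtain ⟨ε, hε, hgε⟩ := Metric.eventually_nhds_iff.1 (hgc0.eventually_lt_const hk0)
  set s := min (δ / 2) (ε / 2) with hs
  have hs0 : 0 < s := by positivity
  have hsδ : s < δ := (min_le_left _ _).trans_lt (by linarith)
  have hsε : s < ε := (min_le_right _ _).trans_lt (by linarith)
  have hcs : ContMDiffOn 𝓘(ℝ, ℝ) (𝓡 2) ∞ c (Icc 0 s) :=
    hc.mono (Icc_subset_Icc (by linarith) hsδ.le)
  have h1 := (h s ⟨hs0, hsδ⟩).trans (dist_le_length hs0.le hcs)
  have h2 : length hNorm c 0 s ≤ ∫ _ in (0 : ℝ)..s, k := by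
    refine intervalIntegral.integral_mono_on_of_le_Ioo hs0.le
      (intervalIntegrable_of_contMDiffOn continuous_hNorm hs0.le hcs) intervalIntegrable_const
      fun t ht => ?_
    rw [hgc t ⟨by linarith [ht.1], ht.2.trans hsδ⟩]
    refine (hgε ?_).le
    rw [Real.dist_eq, sub_zero, abs_of_pos ht.1]
    exact ht.2.trans hsε
  rw [intervalIntegral.integral_const, smul_eq_mul, sub_zero] at h2
  nlinarith

end Distance

/-! ### Geodesic polar coordinates and the Gauss lemma -/

section Polar

variable {M : Type*} [MetricSpace M] [ChartedSpace (EuclideanSpace ℝ (Fin 2)) M]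

theorem velocity_pair {Φ : ℝ × ℝ → M} {ρ ϑ : ℝ → ℝ} {ρ' ϑ' t : ℝ} (hρ : HasDerivAt ρ ρ' t)
    (hϑ : HasDerivAt ϑ ϑ' t) (hΦ : MDifferentiableAt 𝓘(ℝ, ℝ × ℝ) (𝓡 2) Φ (ρ t, ϑ t)) :
    velocity (fun s => Φ (ρ s, ϑ s)) t =
      mfderiv 𝓘(ℝ, ℝ × ℝ) (𝓡 2) Φ (ρ t, ϑ t) ((ρ', ϑ') : ℝ × ℝ) := by
  have h1 : HasMFDerivAt 𝓘(ℝ, ℝ) 𝓘(ℝ, ℝ × ℝ) (fun s => (ρ s, ϑ s)) t _ :=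
    (hρ.prodMk hϑ).hasFDerivAt.hasMFDerivAt
  have h2 := (hΦ.hasMFDerivAt.comp t h1).mfderiv
  unfold velocity
  change mfderiv 𝓘(ℝ, ℝ) (𝓡 2) (Φ ∘ fun s => (ρ s, ϑ s)) t (1 : ℝ) = _
  rw [h2]
  have h5 : (ContinuousLinearMap.toSpanSingleton ℝ ((ρ', ϑ') : ℝ × ℝ)) (1 : ℝ) = (ρ', ϑ') := by
    simp
  exact congrArg (mfderiv 𝓘(ℝ, ℝ × ℝ) (𝓡 2) Φ (ρ t, ϑ t)) h5

theorem velocity_pair_eq_add {Φ : ℝ × ℝ → M} {ρ ϑ : ℝ → ℝ} {ρ' ϑ' t : ℝ} (hρ : HasDerivAt ρ ρ' t)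
    (hϑ : HasDerivAt ϑ ϑ' t) (hΦ : MDifferentiableAt 𝓘(ℝ, ℝ × ℝ) (𝓡 2) Φ (ρ t, ϑ t)) :
    velocity (fun s => Φ (ρ s, ϑ s)) t =
      ρ' • velocity (fun r => Φ (r, ϑ t)) (ρ t) + ϑ' • dTheta Φ (ρ t) (ϑ t) := by
  unfold dTheta
  rw [velocity_pair hρ hϑ hΦ,
    velocity_pair (ρ := fun r => r) (ϑ := fun _ => ϑ t) (hasDerivAt_id' _) (hasDerivAt_const _ _)
      hΦ,
    velocity_pair (ρ := fun _ => ρ t) (ϑ := fun r => r) (hasDerivAt_const _ _) (hasDerivAt_id' _)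
      hΦ]
  have key : ∀ A : ℝ × ℝ →L[ℝ] EuclideanSpace ℝ (Fin 2),
      A (ρ', ϑ') = ρ' • A (1, 0) + ϑ' • A (0, 1) := fun A => by
    rw [← map_smul, ← map_smul, ← map_add]
    simp
  exact key _

/-- Needed at the pole, where curves are compared only for `r ≥ 0`. -/
theorem velocity_eq_of_eqOn_right {c c' : ℝ → M} {b : ℝ} (hb : 0 < b)
    (hc : MDifferentiableAt 𝓘(ℝ, ℝ) (𝓡 2) c 0) (hc' : MDifferentiableAt 𝓘(ℝ, ℝ) (𝓡 2) c' 0)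
    (h : EqOn c c' (Ico 0 b)) :
    (velocity c 0 : EuclideanSpace ℝ (Fin 2)) = velocity c' 0 := by
  have hu : UniqueMDiffWithinAt 𝓘(ℝ, ℝ) (Ico 0 b) (0 : ℝ) :=
    (uniqueDiffOn_Ico 0 b 0 ⟨le_rfl, hb⟩).uniqueMDiffWithinAt
  have h1 := mfderivWithin_congr (I := 𝓘(ℝ, ℝ)) (I' := 𝓡 2) h.symm (h ⟨le_rfl, hb⟩).symm
  unfold velocity
  rw [← mfderivWithin_eq_mfderiv hu hc, ← mfderivWithin_eq_mfderiv hu hc', h1]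
  rfl

variable [RiemannianBundle (fun x : M => TangentSpace (𝓡 2) x)]
  {p q : M} {a : ℝ} {Φ : ℝ × ℝ → M}

namespace IsGeodesicPolar

theorem contMDiffAt (hΦ : IsGeodesicPolar p q a Φ) {r : ℝ} (hr : r ∈ Ioo (-(2 * a)) (2 * a))
    (θ : ℝ) : ContMDiffAt 𝓘(ℝ, ℝ × ℝ) (𝓡 2) ∞ Φ (r, θ) :=
  hΦ.smooth.contMDiffAt ((isOpen_Ioo.prod isOpen_univ).mem_nhds ⟨hr, mem_univ _⟩)

theorem mdifferentiableAt (hΦ : IsGeodesicPolar p q a Φ) {r : ℝ}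
    (hr : r ∈ Ioo (-(2 * a)) (2 * a)) (θ : ℝ) :
    MDifferentiableAt 𝓘(ℝ, ℝ × ℝ) (𝓡 2) Φ (r, θ) :=
  (hΦ.contMDiffAt hr θ).mdifferentiableAt (by simp)

theorem mem_Ioo_neg (hΦ : IsGeodesicPolar p q a Φ) {r : ℝ} (hr : r ∈ Ioo 0 (2 * a)) :
    r ∈ Ioo (-(2 * a)) (2 * a) := ⟨by linarith [hr.1, hΦ.a_pos], hr.2⟩

theorem contMDiffAt_curve (hΦ : IsGeodesicPolar p q a Φ) {ρ ϑ : ℝ → ℝ} {t : ℝ}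
    (hρ : ContDiffAt ℝ ∞ ρ t) (hϑ : ContDiffAt ℝ ∞ ϑ t) (ht : ρ t ∈ Ioo (-(2 * a)) (2 * a)) :
    ContMDiffAt 𝓘(ℝ, ℝ) (𝓡 2) ∞ (fun s => Φ (ρ s, ϑ s)) t :=
  (hΦ.contMDiffAt ht (ϑ t)).comp t (hρ.prodMk hϑ).contMDiffAt

theorem exists_eq (hΦ : IsGeodesicPolar p q a Φ) {x : M} (hp : x ≠ p) (hq : x ≠ q) :
    ∃ r ∈ Ioo 0 (2 * a), ∃ θ, Φ (r, θ) = x := by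
  have hx : x ∈ ({p, q} : Set M)ᶜ := by simp [hp, hq]
  obtain ⟨⟨r, θ⟩, ⟨hr, -⟩, h⟩ := hΦ.bijOn.surjOn hx
  exact ⟨r, hr, θ, h⟩

theorem apply_add_int_mul (hΦ : IsGeodesicPolar p q a Φ) {r : ℝ} (hr : r ∈ Ioo 0 (2 * a))
    (θ : ℝ) (n : ℤ) : Φ (r, θ + n * (2 * Real.pi)) = Φ (r, θ) := by
  have : Function.Periodic (fun θ => Φ (r, θ)) (2 * Real.pi) := hΦ.periodic r hr
  exact (this.int_mul n) θ

theorem exists_int_of_eq (hΦ : IsGeodesicPolar p q a Φ) {r : ℝ} (hr : r ∈ Ioo 0 (2 * a))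
    {α β : ℝ} (h : Φ (r, α) = Φ (r, β)) : ∃ n : ℤ, β = α + n * (2 * Real.pi) := by
  have key : ∀ θ : ℝ, ∃ n : ℤ, θ + n * (2 * Real.pi) ∈ Ico 0 (2 * Real.pi) := fun θ => by
    refine ⟨-toIcoDiv Real.two_pi_pos 0 θ, ?_⟩
    have := sub_toIcoDiv_zsmul_mem_Ico Real.two_pi_pos 0 θ
    rw [zero_add, zsmul_eq_mul] at this
    push_cast
    rwa [neg_mul, ← sub_eq_add_neg]
  obtain ⟨m, hm⟩ := key α
  obtain ⟨n, hn⟩ := key β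
  have h1 := hΦ.bijOn.injOn (x₁ := (r, α + m * (2 * Real.pi))) (x₂ := (r, β + n * (2 * Real.pi)))
    ⟨hr, hm⟩ ⟨hr, hn⟩ (by rw [hΦ.apply_add_int_mul hr α m, hΦ.apply_add_int_mul hr β n, h])
  have h2 := congrArg Prod.snd h1
  simp only at h2
  refine ⟨m - n, ?_⟩
  push_cast
  linarith

theorem dTheta_ne_zero (hΦ : IsGeodesicPolar p q a Φ) {r : ℝ} (hr : r ∈ Ioo 0 (2 * a)) (θ : ℝ) :
    dTheta Φ r θ ≠ 0 := by
  have h := velocity_pair (ρ := fun _ => r) (ϑ := fun s => s) (hasDerivAt_const θ r)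
    (hasDerivAt_id' θ) (hΦ.mdifferentiableAt (hΦ.mem_Ioo_neg hr) θ)
  intro h0
  have h1 : mfderiv 𝓘(ℝ, ℝ × ℝ) (𝓡 2) Φ (r, θ) ((0, 1) : ℝ × ℝ) = 0 := h.symm.trans h0
  have h2 := hΦ.immersion r hr θ (h1.trans (map_zero _).symm)
  exact one_ne_zero (congrArg Prod.snd (show ((0, 1) : ℝ × ℝ) = 0 from h2))

section Gauss

variable [IsManifold (𝓡 2) ∞ M]
  [IsContMDiffRiemannianBundle (𝓡 2) ∞ (EuclideanSpace ℝ (Fin 2))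
    (fun x : M => TangentSpace (𝓡 2) x)] [IsRiemannianManifold (𝓡 2) M]

/-- Along $s\mapsto\Phi(r+s,\theta+sk)$ the distance from `p` grows at unit rate, so the triangle
inequality bounds the speed below. -/
theorem one_le_norm_add (hΦ : IsGeodesicPolar p q a Φ) {r : ℝ} (hr : r ∈ Ioo 0 (2 * a)) (θ k : ℝ) :
    1 ≤ ‖velocity (fun ρ => Φ (ρ, θ)) r + k • dTheta Φ r θ‖ := by
  set δ := min r (2 * a - r) / 2 with hδ
  have hm : 0 < min r (2 * a - r) := lt_min hr.1 (by linarith [hr.2])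
  have hδ0 : 0 < δ := half_pos hm
  have hδ1 : δ < r := by linarith [min_le_left r (2 * a - r)]
  have hδ2 : δ < 2 * a - r := by linarith [min_le_right r (2 * a - r)]
  have hmem : ∀ s ∈ Icc (-δ) δ, r + s ∈ Ioo 0 (2 * a) := fun s hs =>
    ⟨by linarith [hs.1], by linarith [hs.2]⟩
  have hc : ContMDiffOn 𝓘(ℝ, ℝ) (𝓡 2) ∞ (fun s => Φ (r + s, θ + s * k)) (Icc (-δ) δ) :=
    fun s hs => (hΦ.contMDiffAt_curve (ρ := fun s => r + s) (ϑ := fun s => θ + s * k)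
      (contDiffAt_const.add contDiffAt_id) (contDiffAt_const.add (contDiffAt_id.mul contDiffAt_const))
      (hΦ.mem_Ioo_neg (hmem s hs))).contMDiffWithinAt
  have h1 := one_le_norm_velocity hδ0 hc fun s hs => by
    have h2 := hΦ.dist_pole (r + s) (hmem s ⟨by linarith [hs.1], hs.2.le⟩) (θ + s * k)
    have h3 := hΦ.dist_pole (r + 0) (hmem 0 ⟨by linarith, by linarith⟩) (θ + 0 * k)
    have h4 := dist_triangle p (Φ (r + 0, θ + 0 * k)) (Φ (r + s, θ + s * k))
    linarith
  have e : ∀ r₀ θ₀, r₀ = r + 0 → θ₀ = θ + 0 * k →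
      ‖velocity (fun ρ => Φ (ρ, θ₀)) r₀ + k • dTheta Φ r₀ θ₀‖ =
        ‖velocity (fun s => Φ (r + s, θ + s * k)) 0‖ := by
    rintro _ _ rfl rfl
    have hθ : HasDerivAt (fun s : ℝ => θ + s * k) k 0 := by
      simpa using ((hasDerivAt_id' (0 : ℝ)).mul_const k).const_add θ
    rw [velocity_pair_eq_add (ρ := fun s => r + s) (ϑ := fun s => θ + s * k)
      ((hasDerivAt_id' (0 : ℝ)).const_add r) hθ
      (hΦ.mdifferentiableAt (hΦ.mem_Ioo_neg (hmem 0 ⟨by linarith, by linarith⟩)) _), one_smul]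
  rwa [e r θ (by ring) (by ring)]

/-- Gauss lemma. -/
theorem inner_dTheta (hΦ : IsGeodesicPolar p q a Φ) {r : ℝ} (hr : r ∈ Ioo 0 (2 * a)) (θ : ℝ) :
    inner ℝ (velocity (fun ρ => Φ (ρ, θ)) r) (dTheta Φ r θ) = 0 := by
  set u := velocity (fun ρ => Φ (ρ, θ)) r
  set w := dTheta Φ r θ
  have hu : ‖u‖ = 1 := hΦ.unit_speed r hr θ
  have hw : 0 < ‖w‖ ^ 2 := by
    have := norm_pos_iff.2 (hΦ.dTheta_ne_zero hr θ)
    positivity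
  have h : ∀ k : ℝ, 0 ≤ 2 * k * inner ℝ u w + k ^ 2 * ‖w‖ ^ 2 := fun k => by
    have h1 : 1 ≤ ‖u + k • w‖ ^ 2 := one_le_pow₀ (hΦ.one_le_norm_add hr θ k)
    rw [norm_add_sq_real, hu, norm_smul, real_inner_smul_right, mul_pow, Real.norm_eq_abs,
      sq_abs] at h1
    linarith
  -- This `k` minimizes the quadratic; its minimum $-\langle u,w\rangle^2/\|w\|^2$ must be
  -- nonnegative.
  have h2 := h (-(inner ℝ u w) / ‖w‖ ^ 2)
  have h3 : 2 * (-(inner ℝ u w) / ‖w‖ ^ 2) * inner ℝ u w +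
      (-(inner ℝ u w) / ‖w‖ ^ 2) ^ 2 * ‖w‖ ^ 2 = -((inner ℝ u w) ^ 2 / ‖w‖ ^ 2) := by
    field_simp
    ring
  rw [h3] at h2
  have h4 : (inner ℝ u w) ^ 2 / ‖w‖ ^ 2 = 0 := le_antisymm (by linarith) (by positivity)
  rcases div_eq_zero_iff.1 h4 with h5 | h5
  · exact pow_eq_zero_iff two_ne_zero |>.1 h5
  · exact absurd h5 hw.ne'

theorem norm_velocity_sq (hΦ : IsGeodesicPolar p q a Φ) {ρ ϑ : ℝ → ℝ} {ρ' ϑ' t : ℝ}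
    (hρ : HasDerivAt ρ ρ' t) (hϑ : HasDerivAt ϑ ϑ' t) (ht : ρ t ∈ Ioo 0 (2 * a)) :
    ‖velocity (fun s => Φ (ρ s, ϑ s)) t‖ ^ 2 = ρ' ^ 2 + ϑ' ^ 2 * ‖dTheta Φ (ρ t) (ϑ t)‖ ^ 2 := by
  rw [velocity_pair_eq_add hρ hϑ (hΦ.mdifferentiableAt (hΦ.mem_Ioo_neg ht) _), norm_add_sq_real,
    norm_smul, norm_smul, real_inner_smul_left, real_inner_smul_right, hΦ.inner_dTheta ht,
    hΦ.unit_speed _ ht, mul_pow, mul_pow, Real.norm_eq_abs, Real.norm_eq_abs, sq_abs, sq_abs]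
  ring

/-- In a local polar lift the radius is `r` itself, so the radial part already uses up the unit
speed and the angle has zero derivative. -/
theorem eventually_eq_radial (hΦ : IsGeodesicPolar p q a Φ) {c : ℝ → M} {r₀ θ₀ : ℝ}
    (hr₀ : r₀ ∈ Ioo 0 (2 * a)) (hc : ContMDiffAt 𝓘(ℝ, ℝ) (𝓡 2) ∞ c r₀)
    (hd : ∀ r ∈ Ioo 0 (2 * a), dist p (c r) = r) (hs : ∀ r ∈ Ioo 0 (2 * a), ‖velocity c r‖ = 1)
    (h₀ : c r₀ = Φ (r₀, θ₀)) : ∀ᶠ r in 𝓝 r₀, c r = Φ (r, θ₀) := by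
  obtain ⟨ζ, hζ0, hζ, hζc⟩ := exists_contDiffAt_lift
    (hΦ.contMDiffAt (hΦ.mem_Ioo_neg hr₀) θ₀) (hΦ.immersion r₀ hr₀ θ₀) hc h₀
  have h1 : ∀ᶠ r in 𝓝 r₀, (ζ r).1 ∈ Ioo 0 (2 * a) :=
    (hζ.continuousAt.fst).eventually_mem (by rw [hζ0]; exact Ioo_mem_nhds hr₀.1 hr₀.2)
  have h2 : ∀ᶠ r in 𝓝 r₀, r ∈ Ioo 0 (2 * a) := Ioo_mem_nhds hr₀.1 hr₀.2
  have h3 : ∀ᶠ r in 𝓝 r₀, ContDiffAt ℝ 1 ζ r := hζ.eventually (by simp)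
  have h4 : ∀ᶠ r in 𝓝 r₀, (ζ r).1 = r := by
    filter_upwards [h1, h2, hζc] with r k1 k2 k3
    have e1 : dist p (Φ (ζ r)) = (ζ r).1 := hΦ.dist_pole _ k1 (ζ r).2
    rw [← e1, k3, hd r k2]
  have h5 : ∀ᶠ r in 𝓝 r₀, HasDerivAt (fun r => (ζ r).2) 0 r := by
    filter_upwards [h1, h2, h3, hζc.eventually_nhds, h4.eventually_nhds] with r k1 k2 k3 k4 k5
    have hζd : DifferentiableAt ℝ ζ r := k3.differentiableAt one_ne_zero
    have e1 : HasDerivAt (fun r => (ζ r).1) 1 r := (hasDerivAt_id' r).congr_of_eventuallyEq k5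
    have e2 : HasDerivAt (fun r => (ζ r).2) (deriv (fun r => (ζ r).2) r) r :=
      hζd.snd.hasDerivAt
    have e3 := hΦ.norm_velocity_sq e1 e2 k1
    have e4 : hNorm _ (velocity (fun s => Φ ((ζ s).1, (ζ s).2)) r) = hNorm _ (velocity c r) :=
      eval_velocity_congr hNorm k4
    unfold hNorm at e4
    rw [e4, hs r k2] at e3
    have e5 : 0 < ‖dTheta Φ (ζ r).1 (ζ r).2‖ ^ 2 := by
      have := norm_pos_iff.2 (hΦ.dTheta_ne_zero k1 (ζ r).2)
      positivity
    have e6 : deriv (fun r => (ζ r).2) r ^ 2 = 0 := by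
      have : deriv (fun r => (ζ r).2) r ^ 2 * ‖dTheta Φ (ζ r).1 (ζ r).2‖ ^ 2 = 0 := by linarith
      exact (mul_eq_zero.1 this).resolve_right e5.ne'
    rw [pow_eq_zero_iff two_ne_zero] at e6
    rwa [e6] at e2
  obtain ⟨ε, hε, hball⟩ := Metric.eventually_nhds_iff_ball.1 h5
  filter_upwards [Metric.ball_mem_nhds r₀ hε, hζc, h4] with r k1 k2 k3
  have := (convex_ball r₀ ε).is_const_of_fderivWithin_eq_zero (𝕜 := ℝ) (f := fun r => (ζ r).2)
    (fun s hs => (hball s hs).differentiableAt.differentiableWithinAt) (fun s hs => by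
      rw [fderivWithin_of_isOpen Metric.isOpen_ball hs]
      have := (hball s hs).hasFDerivAt.fderiv
      rw [this]; simp) k1 (Metric.mem_ball_self hε)
  rw [hζ0] at this
  rw [← k2]
  exact congrArg Φ (Prod.ext k3 this)

theorem exists_eq_radial (hΦ : IsGeodesicPolar p q a Φ) {c : ℝ → M}
    (hc : ∀ r ∈ Ioo 0 (2 * a), ContMDiffAt 𝓘(ℝ, ℝ) (𝓡 2) ∞ c r)
    (hd : ∀ r ∈ Ioo 0 (2 * a), dist p (c r) = r) (hs : ∀ r ∈ Ioo 0 (2 * a), ‖velocity c r‖ = 1) :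
    ∃ θ, ∀ r ∈ Ioo 0 (2 * a), c r = Φ (r, θ) := by
  have ha : a ∈ Ioo 0 (2 * a) := ⟨hΦ.a_pos, by linarith [hΦ.a_pos]⟩
  have hne : c a ≠ p ∧ c a ≠ q := by
    refine ⟨fun h => ?_, fun h => ?_⟩
    · have := hd a ha
      rw [h, dist_self] at this
      exact ha.1.ne this
    · have := hd a ha
      rw [h, hΦ.dist_poles] at this
      exact ha.2.ne' this
  obtain ⟨r, hr, θ, h⟩ := hΦ.exists_eq hne.1 hne.2
  obtain rfl : r = a := by rw [← hΦ.dist_pole r hr θ, h, hd a ha]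
  refine ⟨θ, ?_⟩
  -- The agreement set is open by the local statement and relatively closed by continuity, so it
  -- fills the connected interval.
  have hsub : Ioo 0 (2 * r) ⊆ {s | s ∈ Ioo 0 (2 * r) ∧ c s = Φ (s, θ)} := by
    refine isPreconnected_Ioo.subset_of_closure_inter_subset ?_ ⟨r, ha, ha, h.symm⟩ ?_
    · rw [isOpen_iff_mem_nhds]
      intro s hs'
      filter_upwards [Ioo_mem_nhds hs'.1.1 hs'.1.2,
        hΦ.eventually_eq_radial hs'.1 (hc s hs'.1) hd hs hs'.2] with t k1 k2 using ⟨k1, k2⟩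
    · rintro s ⟨hs', hs''⟩
      refine ⟨hs'', ?_⟩
      have h1 : ContinuousWithinAt c {s | s ∈ Ioo 0 (2 * r) ∧ c s = Φ (s, θ)} s :=
        (hc s hs'').continuousAt.continuousWithinAt
      have h2 : ContinuousWithinAt (fun s => Φ (s, θ))
          {s | s ∈ Ioo 0 (2 * r) ∧ c s = Φ (s, θ)} s :=
        (hΦ.contMDiffAt_curve (ρ := fun s => s) (ϑ := fun _ => θ) contDiffAt_id contDiffAt_const
          (hΦ.mem_Ioo_neg hs'')).continuousAt.continuousWithinAt
      have := mem_closure_iff_nhdsWithin_neBot.1 hs'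
      refine tendsto_nhds_unique h1 (h2.tendsto.congr' ?_)
      filter_upwards [self_mem_nhdsWithin] with t ht using ht.2.symm
  exact fun s hs' => (hsub hs').2

end Gauss

end IsGeodesicPolar

end Polar

/-! ### Rotational symmetry of the metric -/

section Killing

variable {M : Type*} [MetricSpace M] [ChartedSpace (EuclideanSpace ℝ (Fin 2)) M]
  [RiemannianBundle (fun x : M => TangentSpace (𝓡 2) x)]
  {p q : M} {a : ℝ} {Φ : ℝ × ℝ → M}

theorem norm_velocity_comp {f : M → M} (hf : PreservesMetric f) {c : ℝ → M} {t : ℝ}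
    (hf' : MDifferentiableAt (𝓡 2) (𝓡 2) f (c t)) (hc : MDifferentiableAt 𝓘(ℝ, ℝ) (𝓡 2) c t) :
    ‖velocity (fun s => f (c s)) t‖ = ‖velocity c t‖ := by
  rw [velocity_comp hf' hc]
  exact hf (c t) _

namespace IsGeodesicPolar

theorem exists_frame (hΦ : IsGeodesicPolar p q a Φ) :
    ∃ e₁ e₂ : TangentSpace (𝓡 2) p, ‖e₁‖ = 1 ∧ ‖e₂‖ = 1 ∧ inner ℝ e₁ e₂ = 0 ∧
      ∀ θ, (velocity (fun r => Φ (r, θ)) 0 : EuclideanSpace ℝ (Fin 2)) =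
        (Real.cos θ • e₁ + Real.sin θ • e₂) := by
  obtain ⟨e₁, e₂, h1, h2, h3, h⟩ := hΦ.initial
  exact ⟨e₁, e₂, h1, h2, h3, fun θ => congrArg
    (fun v : TangentBundle (𝓡 2) M => (v.2 : EuclideanSpace ℝ (Fin 2))) (h θ)⟩

theorem apply_eq_of_cos_sin_eq (hΦ : IsGeodesicPolar p q a Φ) {r α β : ℝ} (hr : r ∈ Ioo 0 (2 * a))
    (hc : Real.cos α = Real.cos β) (hs : Real.sin α = Real.sin β) : Φ (r, α) = Φ (r, β) := by
  have h := Real.Angle.cos_sin_inj hc hs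
  obtain ⟨n, hn⟩ := Real.Angle.angle_eq_iff_two_pi_dvd_sub.1 h
  have : α = β + n * (2 * Real.pi) := by linarith
  rw [this, hΦ.apply_add_int_mul hr]

theorem norm_dTheta_eq_of_eq (hΦ : IsGeodesicPolar p q a Φ) {r α β : ℝ} (hr : r ∈ Ioo 0 (2 * a))
    (h : Φ (r, α) = Φ (r, β)) : ‖dTheta Φ r α‖ = ‖dTheta Φ r β‖ := by
  obtain ⟨n, rfl⟩ := hΦ.exists_int_of_eq hr h
  unfold dTheta
  rw [← velocity_comp_add_const]
  exact eval_velocity_congr hNorm (Eventually.of_forall fun t =>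
    (hΦ.apply_add_int_mul hr t n).symm)

variable [IsManifold (𝓡 2) ∞ M]
  [IsContMDiffRiemannianBundle (𝓡 2) ∞ (EuclideanSpace ℝ (Fin 2))
    (fun x : M => TangentSpace (𝓡 2) x)] [IsRiemannianManifold (𝓡 2) M]

/-- An isometry fixing the pole is a rotation or a reflection in geodesic polar coordinates. -/
theorem exists_isometry_apply_eq (hΦ : IsGeodesicPolar p q a Φ) {f : M ≃ₘ^∞⟮𝓡 2, 𝓡 2⟯ M}
    (hf : PreservesMetric f) (hfp : f p = p) :
    ∃ g s : ℝ, s ^ 2 = 1 ∧ ∀ r ∈ Ioo 0 (2 * a), ∀ θ, f (Φ (r, θ)) = Φ (r, g - s * θ) := by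
  obtain ⟨e₁, e₂, n1, n2, n12, he⟩ := hΦ.exists_frame
  have h0 : (0 : ℝ) ∈ Ioo (-(2 * a)) (2 * a) := ⟨by linarith [hΦ.a_pos], by linarith [hΦ.a_pos]⟩
  have hfd : ∀ x, MDifferentiableAt (𝓡 2) (𝓡 2) f x := f.mdifferentiable (by simp)
  have hcurve : ∀ r ∈ Ioo (-(2 * a)) (2 * a), ∀ θ,
      ContMDiffAt 𝓘(ℝ, ℝ) (𝓡 2) ∞ (fun r => Φ (r, θ)) r := fun r hr θ =>
    hΦ.contMDiffAt_curve (ρ := fun r => r) (ϑ := fun _ => θ) contDiffAt_id contDiffAt_const hr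
  have hcd : ∀ r ∈ Ioo (-(2 * a)) (2 * a), ∀ θ,
      MDifferentiableAt 𝓘(ℝ, ℝ) (𝓡 2) (fun r => Φ (r, θ)) r := fun r hr θ =>
    (hcurve r hr θ).mdifferentiableAt (by simp)
  have hrad : ∀ θ, ∃ θ', ∀ r ∈ Ioo 0 (2 * a), f (Φ (r, θ)) = Φ (r, θ') := fun θ => by
    refine hΦ.exists_eq_radial (c := fun r => f (Φ (r, θ))) (fun r hr => ?_) (fun r hr => ?_)
      fun r hr => ?_
    · exact (f.contMDiff _).comp r (hcurve r (hΦ.mem_Ioo_neg hr) θ)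
    · have := hf.dist_eq p (Φ (r, θ))
      rw [hfp, hΦ.dist_pole r hr] at this
      exact this
    · rw [norm_velocity_comp hf (hfd _) (hcd r (hΦ.mem_Ioo_neg hr) θ), hΦ.unit_speed r hr]
  choose g hg using hrad
  let A : TangentSpace (𝓡 2) p →L[ℝ] TangentSpace (𝓡 2) p := mfderiv (𝓡 2) (𝓡 2) f p
  -- Compare initial velocities: `f` carries the radial geodesic of angle `θ` to that of angle `g
  -- θ`.
  have hA : ∀ θ, A (Real.cos θ • e₁ + Real.sin θ • e₂) =
      Real.cos (g θ) • e₁ + Real.sin (g θ) • e₂ := fun θ => by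
    have h1 : EqOn (fun r => f (Φ (r, θ))) (fun r => Φ (r, g θ)) (Ico 0 (2 * a)) := fun r hr => by
      rcases hr.1.eq_or_lt with rfl | h
      · simp only [hΦ.center, hfp]
      · exact hg θ r ⟨h, hr.2⟩
    have h2 := velocity_eq_of_eqOn_right (by linarith [hΦ.a_pos])
      ((hfd _).comp (0 : ℝ) (hcd 0 h0 θ)) (hcd 0 h0 (g θ)) h1
    have h3 : velocity (fun r => f (Φ (r, θ))) 0 = _ := velocity_comp (hfd _) (hcd 0 h0 θ)
    have h4 : ∀ x, x = p → ∀ v : EuclideanSpace ℝ (Fin 2),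
        (mfderiv (𝓡 2) (𝓡 2) f x v : EuclideanSpace ℝ (Fin 2)) = A v := by
      rintro _ rfl v; rfl
    rw [← he (g θ), ← h2, ← he θ]
    exact ((h4 _ (hΦ.center θ) _).symm.trans h3.symm)
  let I : M → EuclideanSpace ℝ (Fin 2) → EuclideanSpace ℝ (Fin 2) → ℝ :=
    fun x u w => @inner ℝ (TangentSpace (𝓡 2) x) _ u w
  have hin : ∀ v w : TangentSpace (𝓡 2) p, inner ℝ (A v) (A w) = inner ℝ v w := by
    intro v w
    have h1 : I (f p) (A v) (A w) = inner ℝ v w := inner_mfderiv_eq (hf p) v w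
    rw [hfp] at h1
    exact h1
  have hcomb : ∀ α β γ δ : ℝ, inner ℝ (α • e₁ + β • e₂) (γ • e₁ + δ • e₂) = α * γ + β * δ := by
    intro α β γ δ
    have n21 : inner ℝ e₂ e₁ = 0 := by rw [real_inner_comm, n12]
    simp only [inner_add_left, inner_add_right, real_inner_smul_left, real_inner_smul_right, n12,
      n21, real_inner_self_eq_norm_sq, n1, n2]
    ring
  have hA1 := hA 0
  have hA2 := hA (Real.pi / 2)
  simp only [Real.cos_zero, Real.sin_zero, Real.cos_pi_div_two, Real.sin_pi_div_two, one_smul,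
    zero_smul, add_zero, zero_add] at hA1 hA2
  set c₁ := Real.cos (g 0)
  set s₁ := Real.sin (g 0)
  set c₂ := Real.cos (g (Real.pi / 2))
  set s₂ := Real.sin (g (Real.pi / 2))
  have k1 : c₁ ^ 2 + s₁ ^ 2 = 1 := Real.cos_sq_add_sin_sq _
  have k2 : c₂ ^ 2 + s₂ ^ 2 = 1 := Real.cos_sq_add_sin_sq _
  have k3 : c₁ * c₂ + s₁ * s₂ = 0 := by
    rw [← hcomb, ← n12, ← hin e₁ e₂, hA1, hA2]
  -- Minus the determinant of the orthogonal map `A`: `s = -1` for a rotation, `s = 1` for a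
  -- reflection.
  set s := s₁ * c₂ - c₁ * s₂ with hs
  have hss : s ^ 2 = 1 := by
    have : s ^ 2 + (c₁ * c₂ + s₁ * s₂) ^ 2 = (c₁ ^ 2 + s₁ ^ 2) * (c₂ ^ 2 + s₂ ^ 2) := by
      rw [hs]; ring
    rw [k3, k1, k2] at this
    linarith
  have hc₂ : c₂ = s * s₁ := by
    have : s * s₁ = c₂ * (c₁ ^ 2 + s₁ ^ 2) - c₁ * (c₁ * c₂ + s₁ * s₂) := by rw [hs]; ring
    rw [this, k1, k3]; ring
  have hs₂ : s₂ = -s * c₁ := by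
    have : -s * c₁ = s₂ * (c₁ ^ 2 + s₁ ^ 2) - s₁ * (c₁ * c₂ + s₁ * s₂) := by rw [hs]; ring
    rw [this, k1, k3]; ring
  refine ⟨g 0, s, hss, fun r hr θ => ?_⟩
  rw [hg θ r hr]
  have hsθ : Real.cos (s * θ) = Real.cos θ ∧ Real.sin (s * θ) = s * Real.sin θ := by
    rcases sq_eq_one_iff.1 hss with h | h <;> simp [h]
  have hAθ : A (Real.cos θ • e₁ + Real.sin θ • e₂) =
      (Real.cos (g 0 - s * θ) • e₁ + Real.sin (g 0 - s * θ) • e₂ : TangentSpace (𝓡 2) p) := by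
    rw [map_add, map_smul, map_smul, hA1, hA2, Real.cos_sub, Real.sin_sub, hsθ.1, hsθ.2, hc₂, hs₂]
    module
  have heq : (Real.cos (g θ) • e₁ + Real.sin (g θ) • e₂ : TangentSpace (𝓡 2) p) =
      Real.cos (g 0 - s * θ) • e₁ + Real.sin (g 0 - s * θ) • e₂ := (hA θ).symm.trans hAθ
  refine hΦ.apply_eq_of_cos_sin_eq hr ?_ ?_
  · have := congrArg (fun v => inner ℝ v ((1 : ℝ) • e₁ + (0 : ℝ) • e₂)) heq
    simpa only [hcomb, mul_one, mul_zero, add_zero] using this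
  · have := congrArg (fun v => inner ℝ v ((0 : ℝ) • e₁ + (1 : ℝ) • e₂)) heq
    simpa only [hcomb, mul_one, mul_zero, zero_add] using this

/-- The isometry taking one point of the parallel to the other acts on it by $\theta\mapsto
g-s\theta$ with $s=\pm1$, so it carries $\partial/\partial\theta$ to $\pm\partial/\partial\theta$.
-/
theorem norm_dTheta_eq (hΦ : IsGeodesicPolar p q a Φ) (hp : IsPole p) {r : ℝ}
    (hr : r ∈ Ioo 0 (2 * a)) (α β : ℝ) : ‖dTheta Φ r α‖ = ‖dTheta Φ r β‖ := by
  obtain ⟨f, hf, hfα, hfp⟩ := hp (Φ (r, α)) (Φ (r, β)) (by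
    rw [hΦ.dist_pole r hr, hΦ.dist_pole r hr])
  obtain ⟨g, s, hs, h⟩ := hΦ.exists_isometry_apply_eq hf hfp
  have hd : MDifferentiableAt 𝓘(ℝ, ℝ) (𝓡 2) (fun θ => Φ (r, θ)) α :=
    (hΦ.contMDiffAt_curve (ρ := fun _ => r) (ϑ := fun θ => θ) contDiffAt_const contDiffAt_id
      (hΦ.mem_Ioo_neg hr)).mdifferentiableAt (by simp)
  have h1 : ‖velocity (fun θ => f (Φ (r, θ))) α‖ = ‖dTheta Φ r α‖ :=
    norm_velocity_comp hf (f.mdifferentiable (by simp) _) hd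
  have h2 : ‖velocity (fun θ => f (Φ (r, θ))) α‖ =
      ‖velocity (fun θ => Φ (r, g - s * θ)) α‖ :=
    eval_velocity_congr hNorm (Eventually.of_forall fun θ => h r hr θ)
  have hϑ : HasDerivAt (fun θ => g - s * θ) (-s) α := by
    simpa using ((hasDerivAt_id' α).const_mul s).const_sub g
  have h3 := hΦ.norm_velocity_sq (ρ := fun _ => r) (hasDerivAt_const α r) hϑ hr
  have h4 : ‖velocity (fun θ => Φ (r, g - s * θ)) α‖ ^ 2 = ‖dTheta Φ r (g - s * α)‖ ^ 2 := by
    rw [h3, neg_sq, hs]; ring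
  have h5 := (pow_left_inj₀ (norm_nonneg _) (norm_nonneg _) two_ne_zero).1 h4
  rw [← h1, h2, h5]
  exact hΦ.norm_dTheta_eq_of_eq hr ((h r hr α).symm.trans hfα)

end IsGeodesicPolar

end Killing

/-! ### The wind as a Killing field -/

section Wind

variable {M : Type*} [MetricSpace M] [ChartedSpace (EuclideanSpace ℝ (Fin 2)) M]

theorem isMIntegralCurve_of_velocity {W : (x : M) → TangentSpace (𝓡 2) x} {c : ℝ → M}
    (hc : ∀ t, MDifferentiableAt 𝓘(ℝ, ℝ) (𝓡 2) c t) (h : ∀ t, velocity c t = W (c t)) :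
    IsMIntegralCurve (I := 𝓡 2) c W := fun t => by
  have h1 := (hc t).hasMFDerivAt
  have h2 : mfderiv 𝓘(ℝ, ℝ) (𝓡 2) c t = (1 : ℝ →L[ℝ] ℝ).smulRight (W (c t)) := by
    have key : ∀ (A : ℝ →L[ℝ] EuclideanSpace ℝ (Fin 2)) (w : EuclideanSpace ℝ (Fin 2)), A 1 = w →
        A = (1 : ℝ →L[ℝ] ℝ).smulRight w := by
      rintro A _ rfl
      ext1
      simp
    exact key _ _ (h t)
  rwa [h2] at h1

/-- A connected Hausdorff space with more than one point has no isolated points. -/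
theorem IsTwoSphereOfRevolution.dense_compl_finite
    [RiemannianBundle (fun x : M => TangentSpace (𝓡 2) x)] {p : M}
    (hM : IsTwoSphereOfRevolution p) {s : Set M} (hs : s.Finite) : Dense sᶜ := by
  obtain ⟨e⟩ := hM.sphere
  have hrank : 1 < Module.rank ℝ (EuclideanSpace ℝ (Fin 3)) := by
    rw [← Module.finrank_eq_rank, finrank_euclideanSpace_fin]
    norm_num
  have h1 := isConnected_iff_connectedSpace.1
    (isConnected_sphere hrank (0 : EuclideanSpace ℝ (Fin 3)) zero_le_one)
  have h2 : Nontrivial (Metric.sphere (0 : EuclideanSpace ℝ (Fin 3)) 1) := by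
    refine ⟨⟨EuclideanSpace.single 0 1, by simp⟩, ⟨-EuclideanSpace.single 0 1, by simp⟩, ?_⟩
    intro h
    have h3 : EuclideanSpace.single (0 : Fin 3) (1 : ℝ) = -EuclideanSpace.single 0 1 :=
      congrArg Subtype.val h
    have h4 := congrArg (fun v : EuclideanSpace ℝ (Fin 3) => v 0) h3
    norm_num at h4
  have h3 : ConnectedSpace M := e.symm.surjective.connectedSpace e.symm.continuous
  have h4 : Nontrivial M := e.symm.injective.nontrivial
  have h5 := (dense_univ (X := M)).sdiff_finite hs
  rwa [← compl_eq_univ_sdiff] at h5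

variable [RiemannianBundle (fun x : M => TangentSpace (𝓡 2) x)]
  {p q : M} {a : ℝ} {Φ : ℝ × ℝ → M} {μ : ℝ} {W : (x : M) → TangentSpace (𝓡 2) x} {φ : ℝ → M → M}

theorem IsRotationalWind.norm_lt_one (hW : IsRotationalWind p q a Φ μ W)
    (hΦ : IsGeodesicPolar p q a Φ) (hμ : ∀ r ∈ Ioo 0 (2 * a), ∀ θ, |μ| * ‖dTheta Φ r θ‖ < 1) (x : M) :
    ‖W x‖ < 1 := by
  by_cases hp : x = p
  · rw [hp, hW.north, norm_zero]; exact zero_lt_one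
  by_cases hq : x = q
  · rw [hq, hW.south, norm_zero]; exact zero_lt_one
  obtain ⟨r, hr, θ, rfl⟩ := hΦ.exists_eq hp hq
  rw [hW.eq_dTheta r hr, norm_smul, Real.norm_eq_abs]
  exact hμ r hr θ

variable [IsManifold (𝓡 2) ∞ M]

theorem IsRotationalWind.flow_apply (hW : IsRotationalWind p q a Φ μ W)
    (hΦ : IsGeodesicPolar p q a Φ) (hφ : IsSmoothFlow W φ) {r : ℝ} (hr : r ∈ Ioo 0 (2 * a))
    (θ s : ℝ) : φ s (Φ (r, θ)) = Φ (r, θ + μ * s) := by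
  have hϑ : ∀ t, HasDerivAt (fun t => θ + μ * t) μ t := fun t => by
    simpa using ((hasDerivAt_id' t).const_mul μ).const_add θ
  have hmem := hΦ.mem_Ioo_neg hr
  have h := hφ.eq_of_isMIntegralCurve (c := fun t => Φ (r, θ + μ * t))
    (isMIntegralCurve_of_velocity (fun t => ?_) fun t => ?_) s
  · simpa using h
  · exact (hΦ.contMDiffAt_curve (ρ := fun _ => r) (ϑ := fun t => θ + μ * t) contDiffAt_const
      (contDiffAt_const.add (contDiffAt_const.mul contDiffAt_id)) hmem).mdifferentiableAt (by simp)
  · rw [velocity_pair_eq_add (ρ := fun _ => r) (hasDerivAt_const t r) (hϑ t)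
      (hΦ.mdifferentiableAt hmem _), hW.eq_dTheta r hr, zero_smul, zero_add]

variable [IsContMDiffRiemannianBundle (𝓡 2) ∞ (EuclideanSpace ℝ (Fin 2))
    (fun x : M => TangentSpace (𝓡 2) x)] [IsRiemannianManifold (𝓡 2) M]

/-- Every tangent vector off the poles is the velocity of a curve $\Phi(\rho,\vartheta)$. The flow
adds a constant to $\vartheta$, which leaves $\rho'^2+\vartheta'^2\|\partial/\partial\theta\|^2$
unchanged. -/
theorem IsRotationalWind.norm_mfderiv_flow (hW : IsRotationalWind p q a Φ μ W)
    (hΦ : IsGeodesicPolar p q a Φ) (hp : IsPole p) (hφ : IsSmoothFlow W φ) {r : ℝ}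
    (hr : r ∈ Ioo 0 (2 * a)) (θ s : ℝ) (v : TangentSpace (𝓡 2) (Φ (r, θ))) :
    ‖mfderiv (𝓡 2) (𝓡 2) (φ s) (Φ (r, θ)) v‖ = ‖v‖ := by
  have hdim : Module.finrank ℝ (ℝ × ℝ) = Module.finrank ℝ (EuclideanSpace ℝ (Fin 2)) := by simp
  obtain ⟨⟨x, y⟩, hxy⟩ : ∃ z : ℝ × ℝ, mfderiv 𝓘(ℝ, ℝ × ℝ) (𝓡 2) Φ (r, θ) z = v := by
    have key : ∀ A : ℝ × ℝ →L[ℝ] EuclideanSpace ℝ (Fin 2), Function.Injective A →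
        Function.Surjective A := fun A hA =>
      (LinearMap.injective_iff_surjective_of_finrank_eq_finrank (f := A.toLinearMap) hdim).1 hA
    exact key _ (hΦ.immersion r hr θ) v
  obtain ⟨ρ, hρ0, hρ⟩ : ∃ ρ : ℝ → ℝ, ρ 0 = r ∧ HasDerivAt ρ x 0 :=
    ⟨fun t => r + t * x, by simp, by simpa using ((hasDerivAt_id' (0 : ℝ)).mul_const x).const_add r⟩
  obtain ⟨ϑ, hϑ0, hϑ⟩ : ∃ ϑ : ℝ → ℝ, ϑ 0 = θ ∧ HasDerivAt ϑ y 0 :=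
    ⟨fun t => θ + t * y, by simp, by simpa using ((hasDerivAt_id' (0 : ℝ)).mul_const y).const_add θ⟩
  subst hρ0 hϑ0
  have hd := hΦ.mdifferentiableAt (hΦ.mem_Ioo_neg hr) (ϑ 0)
  have hv : velocity (fun t => Φ (ρ t, ϑ t)) 0 = v := (velocity_pair hρ hϑ hd).trans hxy
  have hc : MDifferentiableAt 𝓘(ℝ, ℝ) (𝓡 2) (fun t => Φ (ρ t, ϑ t)) 0 :=
    MDifferentiableAt.comp (0 : ℝ) hd
      (hρ.prodMk hϑ).differentiableAt.mdifferentiableAt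
  have h1 : ‖velocity (fun t => φ s (Φ (ρ t, ϑ t))) 0‖ =
      ‖velocity (fun t => Φ (ρ t, ϑ t + μ * s)) 0‖ := by
    refine eval_velocity_congr hNorm ?_
    filter_upwards [hρ.continuousAt.eventually_mem (Ioo_mem_nhds hr.1 hr.2)] with t ht
    exact hW.flow_apply hΦ hφ ht _ s
  have h2 : ‖velocity (fun t => Φ (ρ t, ϑ t + μ * s)) 0‖ ^ 2 =
      ‖velocity (fun t => Φ (ρ t, ϑ t)) 0‖ ^ 2 := by
    rw [hΦ.norm_velocity_sq hρ hϑ hr, hΦ.norm_velocity_sq hρ (hϑ.add_const (μ * s)) hr,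
      hΦ.norm_dTheta_eq hp hr (ϑ 0 + μ * s) (ϑ 0)]
  have h3 := (pow_left_inj₀ (norm_nonneg _) (norm_nonneg _) two_ne_zero).1 h2
  rw [velocity_comp (hφ.mdifferentiableAt_time s _) hc, h3, hv] at h1
  exact h1

/-- The wind is a Killing field: its flow acts by isometries. -/
theorem IsRotationalWind.preservesMetric (hW : IsRotationalWind p q a Φ μ W)
    (hM : IsTwoSphereOfRevolution p) (hΦ : IsGeodesicPolar p q a Φ) (hφ : IsSmoothFlow W φ) (s : ℝ) :
    PreservesMetric (φ s) := by
  -- Polar coordinates say nothing at the poles; the identity extends there because it is closed in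
  -- the tangent bundle and holds over a dense set of base points.
  have hdense : Dense ((TotalSpace.proj : TangentBundle (𝓡 2) M → M) ⁻¹' ({p, q} : Set M)ᶜ) :=
    (hM.dense_compl_finite (toFinite _)).preimage
      (FiberBundle.isOpenMap_proj (EuclideanSpace ℝ (Fin 2)) (fun x : M => TangentSpace (𝓡 2) x))
  have hclosed : IsClosed {v : TangentBundle (𝓡 2) M |
      hNorm _ (tangentMap (𝓡 2) (𝓡 2) (φ s) v).2 = hNorm _ v.2} :=
    isClosed_eq (continuous_hNorm.comp ((hφ.contMDiff_time s).continuous_tangentMap (by simp)))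
      continuous_hNorm
  have hsub : (TotalSpace.proj : TangentBundle (𝓡 2) M → M) ⁻¹' ({p, q} : Set M)ᶜ ⊆
      {v | hNorm _ (tangentMap (𝓡 2) (𝓡 2) (φ s) v).2 = hNorm _ v.2} := by
    rintro ⟨x, v⟩ hx
    have hx' : ¬ (x = p ∨ x = q) := hx
    rw [not_or] at hx'
    obtain ⟨r, hr, θ, rfl⟩ := hΦ.exists_eq hx'.1 hx'.2
    exact hW.norm_mfderiv_flow hΦ hM.pole hφ hr θ s v
  intro x v
  exact hclosed.closure_subset_iff.2 hsub (hdense ⟨x, v⟩)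

end Wind

end RandersSphere

theorem mainTheorem3 {M : Type*} [MetricSpace M]
    [ChartedSpace (EuclideanSpace ℝ (Fin 2)) M] [IsManifold (𝓡 2) ∞ M]
    [RiemannianBundle (fun x : M => TangentSpace (𝓡 2) x)]
    [IsContMDiffRiemannianBundle (𝓡 2) ∞ (EuclideanSpace ℝ (Fin 2))
      (fun x : M => TangentSpace (𝓡 2) x)]
    [IsRiemannianManifold (𝓡 2) M]
    (p q : M) (hM : RandersSphere.IsTwoSphereOfRevolution p)
    (a : ℝ) (Φ : ℝ × ℝ → M) (hΦ : RandersSphere.IsGeodesicPolar p q a Φ)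
    (μ : ℝ) (hμ : ∀ r ∈ Ioo 0 (2 * a), ∀ θ, |μ| * ‖RandersSphere.dTheta Φ r θ‖ < 1)
    (W : (x : M) → TangentSpace (𝓡 2) x)
    (hW : RandersSphere.IsRotationalWind p q a Φ μ W)
    (φ : ℝ → M → M) (hφ : RandersSphere.IsSmoothFlow W φ)
    (x : M) (γ : ℝ → M) (l : ℝ) (hl : 0 < l) (hx : γ 0 = x)
    (hγ : RandersSphere.IsUnitGeodesic RandersSphere.hNorm γ 0 l) :
    RandersSphere.IsUnitGeodesic (RandersSphere.randers W) (fun s => φ s (γ s)) 0 l ∧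
      (RandersSphere.IsCutPoint (RandersSphere.randers W) x (fun s => φ s (γ s)) l ↔
        RandersSphere.IsCutPoint RandersSphere.hNorm x γ l) := by
  have hlt := hW.norm_lt_one hΦ hμ
  have hiso := hW.preservesMetric hM hΦ hφ
  have H := RandersSphere.transfers_hNorm_randers hφ hlt hiso
  have H' := RandersSphere.transfers_randers_hNorm hφ hlt hiso
  refine ⟨H.isUnitGeodesic H' hφ.neg_cancel hγ, fun h => ?_,
    H.isCutPoint H' hφ.neg_cancel hφ.cancel_neg⟩
  -- The inverse transfer of $\mathcal P$ is $s\mapsto\varphi(-s,\varphi(s,\gamma(s)))$, which is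
  -- `γ`.
  have := H'.isCutPoint H hφ.cancel_neg hφ.neg_cancel h
  simpa only [hφ.neg_cancel] using this
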